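/- Let $n\ge 2$ be an integer, let $\Omega\subset\mathbf{R}^n$ be open, and let $\Omega_n$ be the Lebesgue measure of the unit ball of $\mathbf{R}^n$. For a measurable $f$ on $\Omega$ with values in $\mathbf{R}^m$ let $f^*(t)=\inf\{s\ge 0: |\{x\in\Omega:|f(x)|>s\}|\le t\}$ be its nonincreasing rearrangement, $f^{**}(t)=\frac1t\int_0^t f^*(s)\,ds$, and $$\|f\|_{L^{n,1}(\Omega)}=\int_0^\infty t^{1/n}f^*(t)\,\frac{dt}{t},\qquad \|f\|_{L^{(n,1)}(\Omega)}=\int_0^\infty t^{1/n}f^{**}(t)\,\frac{dt}{t}.$$ Let $H_0^{1,(n,1)}(\Omega)$ be the closure of $C_0^\infty(\Omega)$ with respect to the norm $\|u\|_{L^{(n,1)}(\Omega)}+\|\nabla u\|_{L^{(n,1)}(\Omega)}$, where $\nabla u$ is the weak gradient. (i) Every $u\in H_0^{1,(n,1)}(\Omega)$ has a version $u^*\in C(\overline\Omega)\cap L^\infty(\Omega)$ such that, if $\Omega\ne\mathbf{R}^n$, $u^*=0$ on $\partial\Omega$; moreover $$\|u\|_{L^\infty(\Omega)}\le\frac{1}{n\,\Omega_n^{1/n}}\,\|\nabla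 u\|_{L^{n,1}(\Omega)}.$$ (ii) The constant is sharp: if $\Omega\neq\emptyset$ and $C\ge 0$ is such that $\|u\|_{L^\infty(\Omega)}\le C\|\nabla u\|_{L^{n,1}(\Omega)}$ for all $u\in H_0^{1,(n,1)}(\Omega)$, then $C\ge 1/(n\,\Omega_n^{1/n})$. Indeed, whenever $r>0$ and the closed ball $\overline B(a,r)$ is contained in $\Omega$, the function $u(x)=\max(1-|x-a|/r,\,0)$ belongs to $H_0^{1,(n,1)}(\Omega)$, satisfies $\|u\|_{L^\infty(\Omega)}=1$, and gives equality in the inequality in (i). -/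

import Mathlib

open MeasureTheory Set Filter Topology
open scoped ENNReal NNReal ContDiff

noncomputable section

namespace SobolevLorentz

/-- Euclidean `n`-space `ℝⁿ`. -/
abbrev Rn (n : ℕ) : Type := EuclideanSpace ℝ (Fin n)

/-- The Lebesgue measure of the unit ball of `ℝⁿ`. -/
def unitBallVolume (n : ℕ) : ℝ := (volume (Metric.ball (0 : Rn n) 1)).toReal

/-- The constant `1 / (n Ωₙ^{1/n})`, where `Ωₙ` is the measure of the unit ball. -/
def embeddingConst (n : ℕ) : ℝ := 1 / ((n : ℝ) * unitBallVolume n ^ (1 / (n : ℝ)))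

section Lorentz

variable {n : ℕ} {F : Type*} [NormedAddCommGroup F]

/-- The distribution function `λ_f(s) = |{x ∈ Ω : |f x| > s}|`. -/
def distribFun (Ω : Set (Rn n)) (f : Rn n → F) (s : ℝ≥0) : ℝ≥0∞ :=
  volume {x | x ∈ Ω ∧ (s : ℝ) < ‖f x‖}

/-- The nonincreasing rearrangement `f*(t) = inf {s ≥ 0 : λ_f(s) ≤ t}`
(used for `t ≥ 0`; the infimum of the empty set is `∞`). -/
def rearr (Ω : Set (Rn n)) (f : Rn n → F) (t : ℝ) : ℝ≥0∞ :=
  ⨅ (s : ℝ≥0) (_ : distribFun Ω f s ≤ ENNReal.ofReal t), (s : ℝ≥0∞)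

/-- The maximal function `f**(t) = (1/t) ∫₀ᵗ f*(s) ds` of the rearrangement (used for `t > 0`). -/
def maxRearr (Ω : Set (Rn n)) (f : Rn n → F) (t : ℝ) : ℝ≥0∞ :=
  (ENNReal.ofReal t)⁻¹ * ∫⁻ s in Ioo 0 t, rearr Ω f s

/-- `‖f‖_{L^{p,1}(Ω)} = ∫₀^∞ t^{1/p} f*(t) dt/t`. -/
def lorentzNorm (p : ℝ) (Ω : Set (Rn n)) (f : Rn n → F) : ℝ≥0∞ :=
  ∫⁻ t in Ioi (0 : ℝ), ENNReal.ofReal (t ^ (1 / p) / t) * rearr Ω f t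

/-- `‖f‖_{L^{(p,1)}(Ω)} = ∫₀^∞ t^{1/p} f**(t) dt/t`. -/
def lorentzMaxNorm (p : ℝ) (Ω : Set (Rn n)) (f : Rn n → F) : ℝ≥0∞ :=
  ∫⁻ t in Ioi (0 : ℝ), ENNReal.ofReal (t ^ (1 / p) / t) * maxRearr Ω f t

end Lorentz

variable {n : ℕ}

/-- `φ ∈ C₀^∞(Ω)`: smooth with compact support contained in `Ω`. -/
def IsTestFun (Ω : Set (Rn n)) (φ : Rn n → ℝ) : Prop :=
  ContDiff ℝ ∞ φ ∧ HasCompactSupport φ ∧ tsupport φ ⊆ Ω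

/-- `v = (∂₁u, …, ∂ₙu)` on `Ω` in the weak sense. Only the values of `u`, `v` on `Ω` matter. -/
def HasWeakGradient (Ω : Set (Rn n)) (u : Rn n → ℝ) (v : Rn n → Rn n) : Prop :=
  LocallyIntegrableOn u Ω ∧ LocallyIntegrableOn v Ω ∧
    ∀ φ : Rn n → ℝ, IsTestFun Ω φ → ∀ i : Fin n,
      ∫ x in Ω, φ x * v x i = -∫ x in Ω, fderiv ℝ φ x (EuclideanSpace.single i 1) * u x

/-- The norm `‖u‖_{L^{(p,1)}(Ω)} + ‖v‖_{L^{(p,1)}(Ω; ℝⁿ)}` of `H^{1,(p,1)}(Ω)` (with `v = ∇u`). -/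
def sobolevLorentzNorm (p : ℝ) (Ω : Set (Rn n)) (u : Rn n → ℝ) (v : Rn n → Rn n) : ℝ≥0∞ :=
  lorentzMaxNorm p Ω u + lorentzMaxNorm p Ω v

/-- `u ∈ H₀^{1,(p,1)}(Ω)`, the closure of `C₀^∞(Ω)` in the norm of `H^{1,(p,1)}(Ω)`: `u` has a weak
gradient and some sequence of test functions converges to `u` in the Sobolev–Lorentz norm. -/
def MemH0 (p : ℝ) (Ω : Set (Rn n)) (u : Rn n → ℝ) : Prop :=
  ∃ v : Rn n → Rn n, HasWeakGradient Ω u v ∧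
    ∃ φ : ℕ → Rn n → ℝ, (∀ k, IsTestFun Ω (φ k)) ∧
      Tendsto (fun k => sobolevLorentzNorm p Ω (fun x => φ k x - u x)
        (fun x => gradient (φ k) x - v x)) atTop (𝓝 0)

/-- The function equal to `1 - |x - a| / r` for `|x - a| ≤ r` and to `0` elsewhere. -/
def cone (a : Rn n) (r : ℝ) (x : Rn n) : ℝ := max (1 - ‖x - a‖ / r) 0

end SobolevLorentz

end

/-! For a test function `φ`, integrate its derivative along each ray from `x` and then over the unit
sphere, whose measure is `n Ωₙ`. In polar coordinates this gives `n Ωₙ |φ(x)| ≤ ∫ |∇φ(y)| |y -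
x|^{1-n} dy` (`enorm_le_lintegral_gradient_riesz`). By the Hardy–Littlewood inequality
(`lintegral_mul_le_lintegral_rearr`) the right side is at most the integral of the product of the
two rearrangements. That of the kernel is at most `Ωₙ^{1-1/n} t^{1/n} / t`, which is exactly the
Lorentz weight, so dividing by `n Ωₙ` leaves the constant `1 / (n Ωₙ^{1/n})`.

The same bound for differences makes an approximating sequence of test functions uniformly Cauchy.
Its limit is continuous, bounded and zero off `Ω`. Convergence in measure identifies it with `u`
almost everywhere, and the estimate passes to the limit (`MemH0.exists_continuous_version`).

For sharpness, the gradient of a cone has length at most `1 / r` and lives on a ball of measure `Ωₙ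
rⁿ`, so its Lorentz norm is at most `n Ωₙ^{1/n}`. As the cone has supremum `1`, equality is forced.
Membership of the cone in the closure comes from explicit smooth approximations that stay supported
in the closed ball, with uniformly bounded gradients, and from dominated convergence in `L^{(p,1)}`
(`tendsto_lorentzMaxNorm_zero`), where `p > 1` makes the tail integrable. -/

namespace SobolevLorentz

/-! ### Elementary properties of rearrangements. -/

section Rearrangement

variable {n : ℕ} {F : Type*} [NormedAddCommGroup F] {Ω : Set (Rn n)} {f g : Rn n → F}

theorem distribFun_eq_restrict (hΩ : MeasurableSet Ω) (f : Rn n → F) (s : ℝ≥0) :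
    distribFun Ω f s = volume.restrict Ω {x | (s : ℝ) < ‖f x‖} := by
  rw [Measure.restrict_apply' hΩ, distribFun, inter_comm]
  rfl

theorem rearr_congr_ae (hΩ : MeasurableSet Ω) (h : f =ᵐ[volume.restrict Ω] g) :
    rearr Ω f = rearr Ω g := by
  have : distribFun Ω f = distribFun Ω g := by
    ext s
    rw [distribFun_eq_restrict hΩ, distribFun_eq_restrict hΩ]
    refine measure_congr ?_
    filter_upwards [h] with x hx
    change ((s : ℝ) < ‖f x‖) = ((s : ℝ) < ‖g x‖)
    rw [hx]
  ext t
  simp only [rearr, this]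

theorem lorentzNorm_congr_ae (hΩ : MeasurableSet Ω) (h : f =ᵐ[volume.restrict Ω] g) (p : ℝ) :
    lorentzNorm p Ω f = lorentzNorm p Ω g := by
  simp only [lorentzNorm, rearr_congr_ae hΩ h]

theorem distribFun_antitone (Ω : Set (Rn n)) (f : Rn n → F) : Antitone (distribFun Ω f) := by
  intro s t hst
  refine measure_mono fun x hx => ⟨hx.1, lt_of_le_of_lt ?_ hx.2⟩
  exact_mod_cast hst

theorem rearr_antitone (Ω : Set (Rn n)) (f : Rn n → F) : Antitone (rearr Ω f) := by
  intro s t hst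
  exact le_iInf₂ fun r hr => iInf₂_le r (hr.trans (ENNReal.ofReal_le_ofReal hst))

theorem measurable_rearr (Ω : Set (Rn n)) (f : Rn n → F) : Measurable (rearr Ω f) :=
  (rearr_antitone Ω f).measurable

theorem rearr_le_of_distribFun_le {s : ℝ≥0} {t : ℝ}
    (h : distribFun Ω f s ≤ ENNReal.ofReal t) : rearr Ω f t ≤ s :=
  iInf₂_le s h

theorem le_rearr_of_lt_distribFun {s : ℝ≥0} {t : ℝ}
    (h : ENNReal.ofReal t < distribFun Ω f s) : (s : ℝ≥0∞) ≤ rearr Ω f t := by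
  refine le_iInf₂ fun r hr => ?_
  by_contra! hlt
  exact absurd (h.trans_le ((distribFun_antitone Ω f (ENNReal.coe_lt_coe.1 hlt).le).trans hr))
    (lt_irrefl _)

theorem rearr_le_maxRearr {t : ℝ} (ht : 0 < t) : rearr Ω f t ≤ maxRearr Ω f t := by
  have ht' : ENNReal.ofReal t ≠ 0 := by simpa using ht
  have h : rearr Ω f t * ENNReal.ofReal t ≤ ∫⁻ s in Ioo 0 t, rearr Ω f s := by
    calc rearr Ω f t * ENNReal.ofReal t = ∫⁻ _ in Ioo 0 t, rearr Ω f t := by simp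
      _ ≤ _ := setLIntegral_mono' measurableSet_Ioo fun s hs => rearr_antitone Ω f hs.2.le
  calc rearr Ω f t = (ENNReal.ofReal t)⁻¹ * (rearr Ω f t * ENNReal.ofReal t) := by
        rw [mul_comm (rearr Ω f t), ← mul_assoc, ENNReal.inv_mul_cancel ht' ENNReal.ofReal_ne_top,
          one_mul]
    _ ≤ _ := mul_le_mul_right h _

theorem lorentzNorm_le_lorentzMaxNorm (p : ℝ) (Ω : Set (Rn n)) (f : Rn n → F) :
    lorentzNorm p Ω f ≤ lorentzMaxNorm p Ω f :=
  setLIntegral_mono' measurableSet_Ioi fun _ ht => mul_le_mul_right (rearr_le_maxRearr ht) _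

/-- The levels `s` on the left all lie below `f*(t)`. This turns the layer-cake form of the
Hardy–Littlewood inequality into one about `rearr`. -/
theorem volume_setOf_lt_distribFun_le (Ω : Set (Rn n)) (f : Rn n → F) (t : ℝ) :
    volume {s : ℝ | 0 < s ∧ ENNReal.ofReal t < distribFun Ω f s.toNNReal} ≤ rearr Ω f t := by
  by_cases htop : rearr Ω f t = ⊤
  · simp [htop]
  calc volume {s : ℝ | 0 < s ∧ ENNReal.ofReal t < distribFun Ω f s.toNNReal}
      ≤ volume (Ioc 0 (rearr Ω f t).toReal) := by
        refine measure_mono fun s hs => ⟨hs.1, ?_⟩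
        have := le_rearr_of_lt_distribFun hs.2
        rw [← ENNReal.toReal_le_toReal (by simp) htop] at this
        simpa [hs.1.le] using this
    _ = rearr Ω f t := by simp [ENNReal.ofReal_toReal htop]

end Rearrangement

/-! ### The Hardy–Littlewood inequality. -/

theorem volume_setOf_pos_ofReal_lt (c : ℝ≥0∞) :
    volume {t : ℝ | 0 < t ∧ ENNReal.ofReal t < c} = c := by
  by_cases hc : c = ⊤
  · subst hc
    have : {t : ℝ | 0 < t ∧ ENNReal.ofReal t < ⊤} = Ioi 0 := by ext; simp
    rw [this, Real.volume_Ioi]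
  · have : {t : ℝ | 0 < t ∧ ENNReal.ofReal t < c} = Ioo 0 c.toReal := by
      ext t
      simp only [mem_ofPred_eq, mem_Ioo]
      refine and_congr_right fun ht => ENNReal.ofReal_lt_iff_lt_toReal ht.le hc
    rw [this, Real.volume_Ioo, sub_zero, ENNReal.ofReal_toReal hc]

/-- The Hardy–Littlewood inequality for the rearrangements of two real functions. -/
theorem lintegral_mul_le_lintegral_rearr {X : Type*} [MeasurableSpace X] (μ : Measure X)
    [SFinite μ] {F G : X → ℝ} (hF : Measurable F) (hG : Measurable G) :
    ∫⁻ x, ENNReal.ofReal (F x) * ENNReal.ofReal (G x) ∂μ ≤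
      ∫⁻ t in Ioi (0 : ℝ), volume {s : ℝ | 0 < s ∧ ENNReal.ofReal t < μ {x | s < F x}} *
        volume {s : ℝ | 0 < s ∧ ENNReal.ofReal t < μ {x | s < G x}} := by
  set ν : Measure ℝ := volume.restrict (Ioi 0) with hν
  have hanti : ∀ H : X → ℝ, Antitone fun s : ℝ => μ {x | s < H x} := fun H s t hst =>
    measure_mono fun x (hx : t < H x) => lt_of_le_of_lt hst hx
  have hlevel : ∀ (S : Set ℝ), MeasurableSet S →
      ∫⁻ s, S.indicator 1 s ∂ν = volume {s | 0 < s ∧ s ∈ S} := by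
    intro S hS
    rw [lintegral_indicator_one hS, hν, Measure.restrict_apply hS, inter_comm]
    rfl
  have hset : ∀ H : X → ℝ, ∀ x, ENNReal.ofReal (H x) = ∫⁻ s, (Iio (H x)).indicator 1 s ∂ν := by
    intro H x
    rw [hlevel _ measurableSet_Iio]
    change _ = volume (Ioo 0 (H x))
    simp
  have hmeasL : ∀ H : X → ℝ, ∀ t : ℝ≥0∞, MeasurableSet {s : ℝ | t < μ {x | s < H x}} :=
    fun H t => measurableSet_lt measurable_const (hanti H).measurable
  -- Writing the minimum as an integral over `t` separates the two level variables again, so that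
  -- the double integral over levels factors for each fixed `t`.
  have hmin : ∀ c d : ℝ≥0∞, min c d = ∫⁻ t, {t : ℝ | ENNReal.ofReal t < c}.indicator 1 t *
      {t : ℝ | ENNReal.ofReal t < d}.indicator 1 t ∂ν := by
    intro c d
    have h1 : ∀ e : ℝ≥0∞, MeasurableSet {t : ℝ | ENNReal.ofReal t < e} := fun e =>
      measurableSet_lt ENNReal.measurable_ofReal measurable_const
    calc min c d = volume {t : ℝ | 0 < t ∧ ENNReal.ofReal t < min c d} :=
          (volume_setOf_pos_ofReal_lt _).symm
      _ = ∫⁻ t, {t : ℝ | ENNReal.ofReal t < min c d}.indicator 1 t ∂ν := (hlevel _ (h1 _)).symm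
      _ = _ := by
          refine lintegral_congr fun t => ?_
          by_cases hc : ENNReal.ofReal t < c <;> by_cases hd : ENNReal.ofReal t < d <;>
            simp [indicator, hc, hd]
  have hF' : Measurable fun q : X × (ℝ × ℝ) => (Iio (F q.1)).indicator (1 : ℝ → ℝ≥0∞) q.2.1 :=
    (measurable_const.indicator
      (measurableSet_lt (measurable_snd.fst) (hF.comp measurable_fst)) :
      Measurable ({q : X × (ℝ × ℝ) | q.2.1 < F q.1}.indicator (fun _ => (1 : ℝ≥0∞))))
  have hG' : Measurable fun q : X × (ℝ × ℝ) => (Iio (G q.1)).indicator (1 : ℝ → ℝ≥0∞) q.2.2 :=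
    (measurable_const.indicator
      (measurableSet_lt (measurable_snd.snd) (hG.comp measurable_fst)) :
      Measurable ({q : X × (ℝ × ℝ) | q.2.2 < G q.1}.indicator (fun _ => (1 : ℝ≥0∞))))
  have hFt : Measurable fun q : (ℝ × ℝ) × ℝ =>
      {t : ℝ | ENNReal.ofReal t < μ {x | q.1.1 < F x}}.indicator (1 : ℝ → ℝ≥0∞) q.2 :=
    (measurable_const.indicator
      (measurableSet_lt (ENNReal.measurable_ofReal.comp measurable_snd)
        ((hanti F).measurable.comp measurable_fst.fst)) :
      Measurable ({q : (ℝ × ℝ) × ℝ | ENNReal.ofReal q.2 < μ {x | q.1.1 < F x}}.indicator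
        (fun _ => (1 : ℝ≥0∞))))
  have hGt : Measurable fun q : (ℝ × ℝ) × ℝ =>
      {t : ℝ | ENNReal.ofReal t < μ {x | q.1.2 < G x}}.indicator (1 : ℝ → ℝ≥0∞) q.2 :=
    (measurable_const.indicator
      (measurableSet_lt (ENNReal.measurable_ofReal.comp measurable_snd)
        ((hanti G).measurable.comp measurable_fst.snd)) :
      Measurable ({q : (ℝ × ℝ) × ℝ | ENNReal.ofReal q.2 < μ {x | q.1.2 < G x}}.indicator
        (fun _ => (1 : ℝ≥0∞))))
  calc ∫⁻ x, ENNReal.ofReal (F x) * ENNReal.ofReal (G x) ∂μ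
      = ∫⁻ x, ∫⁻ p, (Iio (F x)).indicator 1 p.1 * (Iio (G x)).indicator 1 p.2 ∂(ν.prod ν) ∂μ := by
        refine lintegral_congr fun x => ?_
        rw [hset F, hset G]
        exact (lintegral_prod_mul (measurable_one.indicator measurableSet_Iio).aemeasurable
          (measurable_one.indicator measurableSet_Iio).aemeasurable).symm
    _ = ∫⁻ p, ∫⁻ x, (Iio (F x)).indicator 1 p.1 * (Iio (G x)).indicator 1 p.2 ∂μ ∂(ν.prod ν) :=
        lintegral_lintegral_swap (hF'.mul hG').aemeasurable
    -- The only inequality in the chain: the intersection of two superlevel sets has at most the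
    -- measure of the smaller one. Everything else is Tonelli.
    _ ≤ ∫⁻ p, min (μ {x | p.1 < F x}) (μ {x | p.2 < G x}) ∂(ν.prod ν) := by
        refine lintegral_mono fun p => ?_
        have : ∀ x, (Iio (F x)).indicator (1 : ℝ → ℝ≥0∞) p.1 * (Iio (G x)).indicator 1 p.2 =
            ({x | p.1 < F x} ∩ {x | p.2 < G x}).indicator 1 x := by
          intro x
          by_cases hc : p.1 < F x <;> by_cases hd : p.2 < G x <;> simp [indicator, hc, hd]
        simp_rw [this]
        rw [lintegral_indicator_one ((measurableSet_lt measurable_const hF).inter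
          (measurableSet_lt measurable_const hG))]
        exact le_min (measure_mono inter_subset_left) (measure_mono inter_subset_right)
    _ = ∫⁻ p, ∫⁻ t, {t : ℝ | ENNReal.ofReal t < μ {x | p.1 < F x}}.indicator 1 t *
          {t : ℝ | ENNReal.ofReal t < μ {x | p.2 < G x}}.indicator 1 t ∂ν ∂(ν.prod ν) := by
        simp_rw [hmin]
    _ = ∫⁻ t, ∫⁻ p, {t : ℝ | ENNReal.ofReal t < μ {x | p.1 < F x}}.indicator 1 t *
          {t : ℝ | ENNReal.ofReal t < μ {x | p.2 < G x}}.indicator 1 t ∂(ν.prod ν) ∂ν :=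
        lintegral_lintegral_swap (hFt.mul hGt).aemeasurable
    _ = _ := by
        refine lintegral_congr fun t => ?_
        have h1 := hlevel _ (hmeasL F (ENNReal.ofReal t))
        have h2 := hlevel _ (hmeasL G (ENNReal.ofReal t))
        simp only [mem_ofPred_eq] at h1 h2
        rw [← h1, ← h2]
        exact lintegral_prod_mul (f := {s : ℝ | ENNReal.ofReal t < μ {x | s < F x}}.indicator 1)
          (g := {s : ℝ | ENNReal.ofReal t < μ {x | s < G x}}.indicator 1)
          (measurable_one.indicator (hmeasL F _)).aemeasurable
          (measurable_one.indicator (hmeasL G _)).aemeasurable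

/-! ### The Riesz kernel and the Lorentz weight. -/

section Riesz

variable {n : ℕ}

theorem unitBallVolume_pos (n : ℕ) : 0 < unitBallVolume n :=
  ENNReal.toReal_pos (Metric.measure_ball_pos _ _ one_pos).ne' measure_ball_lt_top.ne

theorem embeddingConst_pos (hn : 2 ≤ n) : 0 < embeddingConst n := by
  have := unitBallVolume_pos n
  have : (0 : ℝ) < n := by exact_mod_cast (by omega : 0 < n)
  unfold embeddingConst
  positivity

theorem volume_ball_eq_ofReal (x : Rn n) {ρ : ℝ} (hρ : 0 < ρ) :
    volume (Metric.ball x ρ) = ENNReal.ofReal (unitBallVolume n * ρ ^ n) := by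
  rw [Measure.addHaar_ball_of_pos _ _ hρ, ENNReal.ofReal_mul (unitBallVolume_pos n).le, mul_comm,
    unitBallVolume, ENNReal.ofReal_toReal measure_ball_lt_top.ne, finrank_euclideanSpace_fin]

/-- Superlevel sets of the kernel lie in balls about `x`. The ball of measure `t` has radius `ρ = (t
/ Ωₙ)^{1/n}`, and no level `s ≥ ρ^{1-n}` can be exceeded outside it. -/
theorem volume_setOf_lt_riesz_le (hn : 2 ≤ n) (Ω : Set (Rn n)) (x : Rn n) {t : ℝ} (ht : 0 < t) :
    volume {s : ℝ | 0 < s ∧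
        ENNReal.ofReal t < volume.restrict Ω {y | s < (‖y - x‖ ^ (n - 1))⁻¹}} ≤
      ENNReal.ofReal (unitBallVolume n ^ (1 - 1 / (n : ℝ))) *
        ENNReal.ofReal (t ^ (1 / (n : ℝ)) / t) := by
  have hV := unitBallVolume_pos n
  have hn0 : (n : ℝ) ≠ 0 := by exact_mod_cast (by omega : n ≠ 0)
  set ρ : ℝ := (t / unitBallVolume n) ^ (1 / (n : ℝ)) with hρ
  have hρ0 : 0 < ρ := by positivity
  have hρn : ρ ^ n = t / unitBallVolume n := by
    rw [hρ, one_div, Real.rpow_inv_natCast_pow (by positivity) (by omega)]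
  have hT : (ρ ^ (n - 1))⁻¹ =
      unitBallVolume n ^ (1 - 1 / (n : ℝ)) * (t ^ (1 / (n : ℝ)) / t) := by
    have h1 : (ρ ^ (n - 1))⁻¹ = ρ / ρ ^ n := by
      have : ρ ^ n = ρ ^ (n - 1) * ρ := by rw [← pow_succ]; congr 1; omega
      rw [this]; field_simp
    rw [h1, hρn, hρ, Real.div_rpow ht.le hV.le, Real.rpow_sub hV, Real.rpow_one]
    field_simp
  rw [← ENNReal.ofReal_mul (by positivity), ← hT]
  calc _ ≤ volume (Ioo 0 (ρ ^ (n - 1))⁻¹) := by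
        refine measure_mono fun s hs => ⟨hs.1, ?_⟩
        by_contra! hle
        refine absurd hs.2 (not_lt.2 ?_)
        calc volume.restrict Ω {y | s < (‖y - x‖ ^ (n - 1))⁻¹}
            ≤ volume {y | s < (‖y - x‖ ^ (n - 1))⁻¹} := Measure.restrict_apply_le _ _
          _ ≤ volume (Metric.ball x ρ) := by
              refine measure_mono fun y (hy : s < _) => ?_
              rw [Metric.mem_ball, dist_eq_norm]
              by_contra! h
              refine absurd (hle.trans_lt hy) (not_lt.2 ?_)
              gcongr
          _ = ENNReal.ofReal t := by
              rw [volume_ball_eq_ofReal x hρ0, hρn, mul_div_cancel₀ _ hV.ne']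
    _ = _ := by simp

/-- The Riesz potential of order one is bounded by the Lorentz `L^{n,1}` norm. -/
theorem lintegral_riesz_le_lorentzNorm (hn : 2 ≤ n) {F : Type*} [NormedAddCommGroup F]
    {Ω : Set (Rn n)} (hΩ : MeasurableSet Ω)
    {f : Rn n → F} (hf : AEStronglyMeasurable f (volume.restrict Ω)) (x : Rn n) :
    ∫⁻ y in Ω, ‖f y‖ₑ * ENNReal.ofReal (‖y - x‖ ^ (n - 1))⁻¹ ≤
      ENNReal.ofReal (unitBallVolume n ^ (1 - 1 / (n : ℝ))) * lorentzNorm n Ω f := by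
  rw [lorentzNorm_congr_ae hΩ hf.ae_eq_mk]
  set g := hf.mk f
  have hg : Measurable fun y => ‖g y‖ := hf.stronglyMeasurable_mk.norm.measurable
  calc ∫⁻ y in Ω, ‖f y‖ₑ * ENNReal.ofReal (‖y - x‖ ^ (n - 1))⁻¹
      = ∫⁻ y in Ω, ENNReal.ofReal ‖g y‖ * ENNReal.ofReal (‖y - x‖ ^ (n - 1))⁻¹ := by
        refine lintegral_congr_ae ?_
        filter_upwards [hf.ae_eq_mk] with y hy
        rw [hy, ofReal_norm]
    _ ≤ ∫⁻ t in Ioi (0 : ℝ), rearr Ω g t *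
          (ENNReal.ofReal (unitBallVolume n ^ (1 - 1 / (n : ℝ))) *
            ENNReal.ofReal (t ^ (1 / (n : ℝ)) / t)) := by
        refine (lintegral_mul_le_lintegral_rearr _ hg (by fun_prop)).trans ?_
        refine setLIntegral_mono' measurableSet_Ioi fun t ht => ?_
        refine mul_le_mul' ?_ (volume_setOf_lt_riesz_le hn Ω x ht)
        refine le_trans (measure_mono ?_) (volume_setOf_lt_distribFun_le Ω g t)
        intro s hs
        refine ⟨hs.1, ?_⟩
        rw [distribFun_eq_restrict hΩ, Real.coe_toNNReal _ hs.1.le]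
        exact hs.2
    _ = _ := by
        rw [lorentzNorm, ← lintegral_const_mul' _ _ ENNReal.ofReal_ne_top]
        refine lintegral_congr fun t => ?_
        ring

end Riesz

/-! ### Pointwise bounds for test functions by their gradients. -/

section Representation

variable {n : ℕ}

/-- The fundamental theorem of calculus on the ray: compact support removes the endpoint at
infinity, and Cauchy–Schwarz bounds the directional derivative. -/
theorem enorm_le_lintegral_ray {φ : Rn n → ℝ} (hφ : ContDiff ℝ ∞ φ) (hc : HasCompactSupport φ)
    (x e : Rn n) (he : ‖e‖ = 1) :
    ‖φ x‖ₑ ≤ ∫⁻ s in Ioi (0 : ℝ), ‖gradient φ (x + s • e)‖ₑ := by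
  set g : ℝ → ℝ := fun s => φ (x + s • e)
  have hline : ∀ s, HasDerivAt (fun s : ℝ => x + s • e) e s := fun s => by
    simpa using ((hasDerivAt_id s).smul_const e).const_add x
  have hg : ContDiff ℝ 1 g := (hφ.of_le (by simp)).comp (by fun_prop)
  have hderiv : ∀ s, deriv g s = inner ℝ (gradient φ (x + s • e)) e := fun s => by
    have hd : DifferentiableAt ℝ φ (x + s • e) := (hφ.differentiable (by simp)) _
    have := hd.hasFDerivAt.comp_hasDerivAt s (hline s)
    rw [gradient, InnerProductSpace.toDual_symm_apply]
    exact this.deriv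
  have hgc : HasCompactSupport g := by
    obtain ⟨R, hR⟩ := hc.isCompact.isBounded.subset_closedBall x
    refine HasCompactSupport.intro (isCompact_closedBall (0 : ℝ) R) fun s hs => ?_
    by_contra h
    have := hR (subset_tsupport φ h)
    simp [norm_smul, he] at this hs
    linarith
  have hint := hgc.integral_Ioi_deriv_eq hg 0
  have : ‖φ x‖ₑ = ‖∫ s in Ioi (0 : ℝ), deriv g s‖ₑ := by
    rw [hint]; simp [g]
  rw [this]
  refine (enorm_integral_le_lintegral_enorm _).trans (lintegral_mono fun s => ?_)
  rw [hderiv, ← ofReal_norm, ← ofReal_norm]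
  refine ENNReal.ofReal_le_ofReal ((norm_inner_le_norm _ _).trans ?_)
  rw [he, mul_one]

/-- Integration in polar coordinates, for nonnegative functions. -/
theorem lintegral_eq_lintegral_sphere_ray [Nontrivial (Rn n)] {h : Rn n → ℝ≥0∞}
    (hh : Measurable h) :
    ∫⁻ z, h z = ∫⁻ e : Metric.sphere (0 : Rn n) 1,
      (∫⁻ s in Ioi (0 : ℝ), ENNReal.ofReal (s ^ (n - 1)) * h (s • (e : Rn n)))
        ∂(volume : Measure (Rn n)).toSphere := by
  have hmp := (volume : Measure (Rn n)).measurePreserving_homeomorphUnitSphereProd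
  rw [finrank_euclideanSpace_fin] at hmp
  have hm : Measurable fun p : Metric.sphere (0 : Rn n) 1 × Ioi (0 : ℝ) =>
      h ((p.2 : ℝ) • (p.1 : Rn n)) := by fun_prop
  calc ∫⁻ z, h z = ∫⁻ z : ({0}ᶜ : Set (Rn n)), h z ∂(volume.comap Subtype.val) := by
        rw [lintegral_subtype_comap (measurableSet_singleton _).compl h,
          restrict_compl_singleton]
    _ = ∫⁻ p, h ((p.2 : ℝ) • (p.1 : Rn n))
          ∂((volume : Measure (Rn n)).toSphere.prod (.volumeIoiPow (n - 1))) := by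
        rw [← hmp.lintegral_comp hm]
        refine lintegral_congr fun z => ?_
        congr 1
        have hz : ‖(z : Rn n)‖ ≠ 0 := norm_ne_zero_iff.2 z.2
        simp [smul_smul, mul_inv_cancel₀ hz]
    _ = ∫⁻ e, ∫⁻ s, h ((s : ℝ) • (e : Rn n)) ∂(Measure.volumeIoiPow (n - 1))
          ∂(volume : Measure (Rn n)).toSphere := lintegral_prod _ hm.aemeasurable
    _ = _ := by
        refine lintegral_congr fun e => ?_
        rw [Measure.volumeIoiPow, lintegral_withDensity_eq_lintegral_mul _ (by fun_prop)
          (by fun_prop)]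
        exact lintegral_subtype_comap measurableSet_Ioi
          (fun s : ℝ => ENNReal.ofReal (s ^ (n - 1)) * h (s • (e : Rn n)))

theorem continuous_gradient {φ : Rn n → ℝ} (hφ : ContDiff ℝ ∞ φ) : Continuous (gradient φ) :=
  (InnerProductSpace.toDual ℝ (Rn n)).symm.continuous.comp (hφ.continuous_fderiv (by simp))

/-- A compactly supported smooth function is bounded by the Riesz potential of its gradient. -/
theorem enorm_le_lintegral_gradient_riesz (hn : 2 ≤ n) {φ : Rn n → ℝ} (hφ : ContDiff ℝ ∞ φ)
    (hc : HasCompactSupport φ) (x : Rn n) :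
    ENNReal.ofReal (n * unitBallVolume n) * ‖φ x‖ₑ ≤
      ∫⁻ y, ‖gradient φ y‖ₑ * ENNReal.ofReal (‖y - x‖ ^ (n - 1))⁻¹ := by
  have : Nonempty (Fin n) := ⟨⟨0, by omega⟩⟩
  have hcont := continuous_gradient hφ
  have htrans : ∫⁻ y, ‖gradient φ y‖ₑ * ENNReal.ofReal (‖y - x‖ ^ (n - 1))⁻¹ =
      ∫⁻ z, ‖gradient φ (x + z)‖ₑ * ENNReal.ofReal (‖z‖ ^ (n - 1))⁻¹ := by
    rw [← lintegral_add_left_eq_self _ x]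
    simp
  have hm : Measurable fun z => ‖gradient φ (x + z)‖ₑ * ENNReal.ofReal (‖z‖ ^ (n - 1))⁻¹ :=
    (hcont.comp (by fun_prop : Continuous fun z => x + z)).measurable.enorm.mul (by fun_prop)
  rw [htrans, lintegral_eq_lintegral_sphere_ray hm]
  have hsphere : (volume : Measure (Rn n)).toSphere univ =
      ENNReal.ofReal (n * unitBallVolume n) := by
    rw [Measure.toSphere_apply_univ, finrank_euclideanSpace_fin, unitBallVolume,
      ENNReal.ofReal_mul (by positivity), ENNReal.ofReal_toReal measure_ball_lt_top.ne,
      ENNReal.ofReal_natCast]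
  calc ENNReal.ofReal (n * unitBallVolume n) * ‖φ x‖ₑ
      = ∫⁻ _, ‖φ x‖ₑ ∂(volume : Measure (Rn n)).toSphere := by
        rw [lintegral_const, hsphere, mul_comm]
    _ ≤ _ := by
        -- Direction by direction, the polar Jacobian `s^{n-1}` cancels the kernel, leaving the ray
        -- estimate.
        refine lintegral_mono fun e => ?_
        have he : ‖(e : Rn n)‖ = 1 := by simp
        refine (enorm_le_lintegral_ray hφ hc x e he).trans_eq ?_
        refine setLIntegral_congr_fun measurableSet_Ioi fun s (hs : 0 < s) => ?_
        have : ‖s • (e : Rn n)‖ = s := by rw [norm_smul, he, mul_one, Real.norm_of_nonneg hs.le]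
        simp only [this]
        rw [mul_left_comm, ← ENNReal.ofReal_mul (by positivity),
          mul_inv_cancel₀ (by positivity), ENNReal.ofReal_one, mul_one]

theorem gradient_eq_zero_of_notMem {Ω : Set (Rn n)} {φ : Rn n → ℝ} (hφ : IsTestFun Ω φ)
    {x : Rn n} (hx : x ∉ Ω) : gradient φ x = 0 := by
  have : fderiv ℝ φ x = 0 := by
    by_contra h
    exact hx (hφ.2.2 (support_fderiv_subset ℝ h))
  simp [gradient, this]

theorem IsTestFun.sub {Ω : Set (Rn n)} {φ ψ : Rn n → ℝ} (hφ : IsTestFun Ω φ)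
    (hψ : IsTestFun Ω ψ) : IsTestFun Ω (fun x => φ x - ψ x) :=
  ⟨hφ.1.sub hψ.1, hφ.2.1.sub hψ.2.1,
    (tsupport_sub φ ψ).trans (union_subset hφ.2.2 hψ.2.2)⟩

/-- A test function is bounded by the Lorentz norms of two fields whose sum dominates its
gradient. -/
theorem enorm_le_of_gradient_le (hn : 2 ≤ n) {Ω : Set (Rn n)} (hΩ : MeasurableSet Ω)
    {φ : Rn n → ℝ} (hφ : IsTestFun Ω φ) {f g : Rn n → Rn n}
    (hf : AEStronglyMeasurable f (volume.restrict Ω))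
    (hg : AEStronglyMeasurable g (volume.restrict Ω))
    (hle : ∀ y, ‖gradient φ y‖ₑ ≤ ‖f y‖ₑ + ‖g y‖ₑ) (x : Rn n) :
    ‖φ x‖ₑ ≤ ENNReal.ofReal (embeddingConst n) * (lorentzNorm n Ω f + lorentzNorm n Ω g) := by
  have hV := unitBallVolume_pos n
  have hn0 : (0 : ℝ) < n := by exact_mod_cast (by omega : 0 < n)
  have hK : ENNReal.ofReal (n * unitBallVolume n) * ‖φ x‖ₑ ≤
      ENNReal.ofReal (unitBallVolume n ^ (1 - 1 / (n : ℝ))) *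
        (lorentzNorm n Ω f + lorentzNorm n Ω g) := by
    calc _ ≤ ∫⁻ y, ‖gradient φ y‖ₑ * ENNReal.ofReal (‖y - x‖ ^ (n - 1))⁻¹ :=
          enorm_le_lintegral_gradient_riesz hn hφ.1 hφ.2.1 x
      _ = ∫⁻ y in Ω, ‖gradient φ y‖ₑ * ENNReal.ofReal (‖y - x‖ ^ (n - 1))⁻¹ := by
          rw [← lintegral_indicator hΩ]
          refine lintegral_congr fun y => ?_
          by_cases hy : y ∈ Ω
          · simp [hy]
          · simp [hy, gradient_eq_zero_of_notMem hφ hy]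
      -- The sum is split here, under the integral, so that subadditivity of `lorentzNorm` is never
      -- needed.
      _ ≤ ∫⁻ y in Ω, (‖f y‖ₑ * ENNReal.ofReal (‖y - x‖ ^ (n - 1))⁻¹ +
            ‖g y‖ₑ * ENNReal.ofReal (‖y - x‖ ^ (n - 1))⁻¹) := by
          refine lintegral_mono fun y => ?_
          rw [← add_mul]
          exact mul_le_mul_left (hle y) _
      _ = (∫⁻ y in Ω, ‖f y‖ₑ * ENNReal.ofReal (‖y - x‖ ^ (n - 1))⁻¹) +
            ∫⁻ y in Ω, ‖g y‖ₑ * ENNReal.ofReal (‖y - x‖ ^ (n - 1))⁻¹ :=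
          lintegral_add_left' (hf.enorm.mul (Measurable.aemeasurable (by fun_prop))) _
      _ ≤ _ := by
          rw [mul_add]
          exact add_le_add (lintegral_riesz_le_lorentzNorm hn hΩ hf x)
            (lintegral_riesz_le_lorentzNorm hn hΩ hg x)
  have hconst : embeddingConst n =
      (n * unitBallVolume n)⁻¹ * unitBallVolume n ^ (1 - 1 / (n : ℝ)) := by
    rw [embeddingConst, Real.rpow_sub hV, Real.rpow_one]
    field_simp
  calc ‖φ x‖ₑ = ENNReal.ofReal (n * unitBallVolume n)⁻¹ *
        (ENNReal.ofReal (n * unitBallVolume n) * ‖φ x‖ₑ) := by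
        rw [← mul_assoc, ← ENNReal.ofReal_mul (by positivity), inv_mul_cancel₀ (by positivity),
          ENNReal.ofReal_one, one_mul]
    _ ≤ _ := (mul_le_mul_right hK _)
    _ = _ := by rw [← mul_assoc, ← ENNReal.ofReal_mul (by positivity), ← hconst]

end Representation

/-! ### Convergence in measure, uniqueness of weak gradients, and the continuous version. -/

variable {n : ℕ}

theorem lintegral_Ioo_rpow_div {p : ℝ} (hp : 0 < p) {δ : ℝ} (hδ : 0 ≤ δ) :
    ∫⁻ t in Ioo 0 δ, ENNReal.ofReal (t ^ (1 / p) / t) = ENNReal.ofReal (p * δ ^ (1 / p)) := by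
  have hp' : -1 < 1 / p - 1 := by
    have : 0 < 1 / p := by positivity
    linarith
  have hcongr : ∫⁻ t in Ioo 0 δ, ENNReal.ofReal (t ^ (1 / p) / t) =
      ∫⁻ t in Ioc 0 δ, ENNReal.ofReal (t ^ (1 / p - 1)) := by
    rw [Measure.restrict_congr_set Ioo_ae_eq_Ioc]
    refine setLIntegral_congr_fun measurableSet_Ioc fun t ht => ?_
    simp only [Real.rpow_sub_one ht.1.ne']
  rw [hcongr, ← ofReal_integral_eq_lintegral_ofReal
    (intervalIntegral.intervalIntegrable_rpow' hp').1, ← intervalIntegral.integral_of_le hδ,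
    integral_rpow (Or.inl hp')]
  · rw [sub_add_cancel, Real.zero_rpow (by positivity)]
    congr 1
    field_simp
    ring
  · filter_upwards [ae_restrict_mem measurableSet_Ioc] with t ht
    exact Real.rpow_nonneg ht.1.le _

/-- A Chebyshev inequality: the rearrangement is at least `s` on all of `(0, δ)`. -/
theorem mul_le_lorentzNorm_of_lt_distribFun {F : Type*} [NormedAddCommGroup F] {p : ℝ}
    (hp : 0 < p) {Ω : Set (Rn n)} {f : Rn n → F} {s : ℝ≥0} {δ : ℝ} (hδ : 0 ≤ δ)
    (h : ENNReal.ofReal δ < distribFun Ω f s) :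
    ENNReal.ofReal (p * δ ^ (1 / p)) * s ≤ lorentzNorm p Ω f := by
  rw [← lintegral_Ioo_rpow_div hp hδ, ← lintegral_mul_const' _ _ ENNReal.coe_ne_top]
  calc _ ≤ ∫⁻ t in Ioo 0 δ, ENNReal.ofReal (t ^ (1 / p) / t) * rearr Ω f t := by
        refine setLIntegral_mono' measurableSet_Ioo fun t ht => mul_le_mul_right ?_ _
        exact (le_rearr_of_lt_distribFun h).trans (rearr_antitone Ω f ht.2.le)
    _ ≤ _ := lintegral_mono_set Ioo_subset_Ioi_self

theorem tendstoInMeasure_of_tendsto_lorentzNorm {F : Type*} [NormedAddCommGroup F] {p : ℝ}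
    (hp : 0 < p) {Ω : Set (Rn n)} (hΩ : MeasurableSet Ω) {f : ℕ → Rn n → F} {g : Rn n → F}
    (h : Tendsto (fun k => lorentzNorm p Ω (fun x => f k x - g x)) atTop (𝓝 0)) :
    TendstoInMeasure (volume.restrict Ω) f atTop g := by
  intro ε hε
  obtain ⟨s, hs0, hsε⟩ := ENNReal.lt_iff_exists_nnreal_btwn.1 hε
  rw [ENNReal.tendsto_nhds_zero]
  intro δ hδ
  obtain ⟨d, hd0, hdδ⟩ := ENNReal.lt_iff_exists_nnreal_btwn.1 hδ
  have hd0' : (0 : ℝ) < d := by exact_mod_cast hd0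
  have hs0' : s ≠ 0 := by exact_mod_cast hs0.ne'
  have hpos : 0 < ENNReal.ofReal (p * (d : ℝ) ^ (1 / p)) * s := by
    refine ENNReal.mul_pos ?_ (by exact_mod_cast hs0')
    have : 0 < p * (d : ℝ) ^ (1 / p) := by positivity
    simpa using this
  filter_upwards [h.eventually (gt_mem_nhds hpos)] with k hk
  refine le_trans ?_ hdδ.le
  calc volume.restrict Ω {x | ε ≤ edist (f k x) (g x)}
      ≤ distribFun Ω (fun x => f k x - g x) s := by
        rw [distribFun_eq_restrict hΩ]
        refine measure_mono fun x (hx : ε ≤ _) => ?_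
        have := hsε.trans_le hx
        rw [edist_eq_enorm_sub, enorm_eq_nnnorm, ENNReal.coe_lt_coe] at this
        exact_mod_cast this
    _ ≤ d := by
        by_contra! hlt
        rw [← ENNReal.ofReal_coe_nnreal] at hlt
        exact absurd (mul_le_lorentzNorm_of_lt_distribFun hp hd0'.le hlt) (not_le.2 hk)

theorem locallyIntegrableOn_apply {Ω : Set (Rn n)} {v : Rn n → Rn n}
    (hv : LocallyIntegrableOn v Ω) (i : Fin n) : LocallyIntegrableOn (fun x => v x i) Ω := by
  intro x hx
  obtain ⟨s, hs, hi⟩ := hv x hx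
  exact ⟨s, hs, (EuclideanSpace.proj (𝕜 := ℝ) i).integrable_comp hi⟩

theorem IsTestFun.integrableOn_mul {Ω : Set (Rn n)} {φ : Rn n → ℝ} (hφ : IsTestFun Ω φ)
    {f : Rn n → ℝ} (hf : LocallyIntegrableOn f Ω) :
    IntegrableOn (fun x => φ x * f x) Ω := by
  have hK := hφ.2.1.isCompact
  have h1 : IntegrableOn (fun x => φ x * f x) (tsupport φ) :=
    (hf.integrableOn_compact_subset hφ.2.2 hK).continuousOn_mul hφ.1.continuous.continuousOn hK
  have h2 : Integrable (fun x => φ x * f x) := by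
    refine (integrableOn_iff_integrable_of_support_subset fun x hx => ?_).1 h1
    exact subset_tsupport φ fun h => hx (by simp [h])
  exact h2.integrableOn

/-- Weak gradients are unique almost everywhere. -/
theorem HasWeakGradient.ae_eq {Ω : Set (Rn n)} (hΩ : IsOpen Ω) {u : Rn n → ℝ}
    {v v' : Rn n → Rn n} (h : HasWeakGradient Ω u v) (h' : HasWeakGradient Ω u v') :
    v =ᵐ[volume.restrict Ω] v' := by
  have key : ∀ i : Fin n, ∀ᵐ x, x ∈ Ω → v x i - v' x i = 0 := by
    intro i
    have hi := locallyIntegrableOn_apply h.2.1 i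
    have hi' := locallyIntegrableOn_apply h'.2.1 i
    refine hΩ.ae_eq_zero_of_integral_contDiff_smul_eq_zero (hi.sub hi') fun g hg hgc hgΩ => ?_
    have hgt : IsTestFun Ω g := ⟨hg, hgc, hgΩ⟩
    have hsupp : ∀ x, x ∉ Ω → g x • (v x i - v' x i) = 0 := fun x hx => by
      rw [image_eq_zero_of_notMem_tsupport fun hx' => hx (hgΩ hx'), zero_smul]
    change ∫ x, g x • (v x i - v' x i) = 0
    rw [← setIntegral_eq_integral_of_forall_compl_eq_zero hsupp]
    simp only [smul_eq_mul, mul_sub]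
    rw [integral_sub (hgt.integrableOn_mul hi) (hgt.integrableOn_mul hi'),
      h.2.2 g hgt i, h'.2.2 g hgt i, sub_self]
  rw [EventuallyEq, ae_restrict_iff' hΩ.measurableSet]
  filter_upwards [ae_all_iff.2 key] with x hx hxΩ
  ext i
  exact sub_eq_zero.1 (hx i hxΩ)

/-- Members of `H₀^{1,(n,1)}(Ω)` have a bounded continuous version, vanishing off `Ω` and bounded
by the Lorentz norm of the gradient. -/
theorem MemH0.exists_continuous_version (hn : 2 ≤ n) {Ω : Set (Rn n)} (hΩ : IsOpen Ω)
    {u : Rn n → ℝ} (hu : MemH0 n Ω u) :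
    ∃ w : Rn n → ℝ, w =ᵐ[volume.restrict Ω] u ∧ Continuous w ∧ (∃ M : ℝ, ∀ x, ‖w x‖ ≤ M) ∧
      (∀ x, x ∉ Ω → w x = 0) ∧ ∀ v : Rn n → Rn n, HasWeakGradient Ω u v →
        ∀ x, ‖w x‖ₑ ≤ ENNReal.ofReal (embeddingConst n) * lorentzNorm n Ω v := by
  obtain ⟨v, hv, φ, hφ, hlim⟩ := hu
  have hn0 : (0 : ℝ) < n := by exact_mod_cast (by omega : 0 < n)
  set C := ENNReal.ofReal (embeddingConst n)
  have hC : C ≠ ⊤ := ENNReal.ofReal_ne_top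
  set e : ℕ → ℝ≥0∞ := fun k => lorentzNorm n Ω (fun x => gradient (φ k) x - v x)
  have hvm : AEStronglyMeasurable v (volume.restrict Ω) := hv.2.1.aestronglyMeasurable
  have hem : ∀ k, AEStronglyMeasurable (fun x => gradient (φ k) x - v x) (volume.restrict Ω) :=
    fun k => (continuous_gradient (hφ k).1).aestronglyMeasurable.sub hvm
  have hule : Tendsto (fun k => lorentzNorm n Ω (fun x => φ k x - u x)) atTop (𝓝 0) :=
    tendsto_of_tendsto_of_tendsto_of_le_of_le tendsto_const_nhds hlim (fun _ => zero_le)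
      fun k => (lorentzNorm_le_lorentzMaxNorm _ _ _).trans le_self_add
  have he : Tendsto e atTop (𝓝 0) :=
    tendsto_of_tendsto_of_tendsto_of_le_of_le tendsto_const_nhds hlim (fun _ => zero_le)
      fun k => (lorentzNorm_le_lorentzMaxNorm _ _ _).trans le_add_self
  -- The gradient is split as `(∇φₖ - v) + v`. For `hcauchy` below it is the difference of the two
  -- errors, so `v` itself drops out.
  have hbound : ∀ k x, ‖φ k x‖ₑ ≤ C * (e k + lorentzNorm n Ω v) := fun k x =>
    enorm_le_of_gradient_le hn hΩ.measurableSet (hφ k) (hem k) hvm (fun y => by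
      simpa using enorm_add_le (gradient (φ k) y - v y) (v y)) x
  have hgradsub : ∀ j k y, gradient (fun x => φ j x - φ k x) y =
      gradient (φ j) y - gradient (φ k) y := fun j k y => by
    have hj : DifferentiableAt ℝ (φ j) y := (hφ j).1.differentiable (by simp) y
    have hk : DifferentiableAt ℝ (φ k) y := (hφ k).1.differentiable (by simp) y
    rw [gradient, gradient, gradient, fderiv_fun_sub hj hk, map_sub]
  have hcauchy : ∀ j k x, ‖φ j x - φ k x‖ₑ ≤ C * (e j + e k) := fun j k x =>
    enorm_le_of_gradient_le hn hΩ.measurableSet ((hφ j).sub (hφ k)) (hem j) (hem k) (fun y => by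
      rw [hgradsub]
      calc _ = ‖(gradient (φ j) y - v y) - (gradient (φ k) y - v y)‖ₑ := by congr 1; abel
        _ ≤ _ := enorm_sub_le) x
  have hunif : UniformCauchySeqOn φ atTop univ := by
    intro V hV
    obtain ⟨ε, hε, hεV⟩ := mem_uniformity_edist.1 hV
    have h0 : Tendsto (fun p : ℕ × ℕ => C * (e p.1 + e p.2)) (atTop ×ˢ atTop) (𝓝 0) := by
      have := ENNReal.Tendsto.const_mul (a := C)
        ((he.comp tendsto_fst).add (he.comp tendsto_snd)) (Or.inr hC)
      simpa using this
    filter_upwards [h0.eventually (gt_mem_nhds hε)] with q hq x _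
    refine hεV ?_
    rw [edist_eq_enorm_sub]
    exact (hcauchy q.1 q.2 x).trans_lt hq
  have hptw : ∀ x, ∃ l, Tendsto (fun k => φ k x) atTop (𝓝 l) := fun x =>
    cauchySeq_tendsto_of_complete (hunif.cauchySeq (mem_univ x))
  choose w hw using hptw
  have hwu : TendstoUniformlyOn φ w atTop univ :=
    hunif.tendstoUniformlyOn_of_tendsto fun x _ => hw x
  refine ⟨w, ?_, ?_, ?_, ?_, ?_⟩
  · obtain ⟨ns, hns, hae⟩ :=
      (tendstoInMeasure_of_tendsto_lorentzNorm hn0 hΩ.measurableSet hule).exists_seq_tendsto_ae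
    filter_upwards [hae] with x hx
    exact tendsto_nhds_unique ((hw x).comp hns.tendsto_atTop) hx
  · exact continuousOn_univ.1
      (hwu.continuousOn (Frequently.of_forall fun k => (hφ k).1.continuous.continuousOn))
  -- Boundedness comes from a single `φ k` uniformly within `1` of `w`, with no need for the Lorentz
  -- norm of `v` to be finite.
  · obtain ⟨k, hk⟩ := (Metric.tendstoUniformlyOn_iff.1 hwu 1 one_pos).exists
    obtain ⟨M, hM⟩ := (hφ k).2.1.exists_bound_of_continuous (hφ k).1.continuous
    refine ⟨1 + M, fun x => ?_⟩
    have h1 := hk x (mem_univ x)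
    rw [dist_eq_norm] at h1
    calc ‖w x‖ = ‖(w x - φ k x) + φ k x‖ := by rw [sub_add_cancel]
      _ ≤ 1 + M := (norm_add_le _ _).trans (add_le_add h1.le (hM x))
  · intro x hx
    refine tendsto_nhds_unique (hw x) ?_
    have : ∀ k, φ k x = 0 := fun k =>
      image_eq_zero_of_notMem_tsupport fun hx' => hx ((hφ k).2.2 hx')
    simp [this]
  · intro v' hv' x
    rw [lorentzNorm_congr_ae hΩ.measurableSet (hv'.ae_eq hΩ hv)]
    have h1 : Tendsto (fun k => ‖φ k x‖ₑ) atTop (𝓝 ‖w x‖ₑ) := (hw x).enorm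
    have h2 : Tendsto (fun k => C * (e k + lorentzNorm n Ω v)) atTop
        (𝓝 (C * (0 + lorentzNorm n Ω v))) :=
      ENNReal.Tendsto.const_mul (he.add tendsto_const_nhds) (Or.inr hC)
    rw [zero_add] at h2
    exact le_of_tendsto_of_tendsto' h1 h2 fun k => hbound k x

/-! ### Dominated convergence in Lorentz norms. -/

section Bounded

variable {F : Type*} [NormedAddCommGroup F] {Ω K : Set (Rn n)} {f : Rn n → F} {M : ℝ≥0}

theorem rearr_le_of_norm_le (hM : ∀ x, ‖f x‖ ≤ M) (t : ℝ) : rearr Ω f t ≤ M := by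
  refine rearr_le_of_distribFun_le ?_
  have : {x | x ∈ Ω ∧ (M : ℝ) < ‖f x‖} = ∅ :=
    eq_empty_of_forall_notMem fun x hx => absurd (hM x) (not_le.2 hx.2)
  simp [distribFun, this]

theorem rearr_eq_zero_of_volume_le (hK : ∀ x, x ∉ K → f x = 0) {t : ℝ}
    (ht : volume K ≤ ENNReal.ofReal t) : rearr Ω f t = 0 := by
  refine le_antisymm ?_ zero_le
  refine (rearr_le_of_distribFun_le (s := 0) (le_trans (measure_mono fun x hx => ?_) ht)).trans
    (by simp)
  by_contra h
  simpa [hK x h] using hx.2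

theorem rearr_le_indicator (hM : ∀ x, ‖f x‖ ≤ M) (hK : ∀ x, x ∉ K → f x = 0)
    (hKfin : volume K ≠ ⊤) (t : ℝ) :
    rearr Ω f t ≤ (Iio (volume K).toReal).indicator (fun _ => (M : ℝ≥0∞)) t := by
  by_cases ht : t < (volume K).toReal
  · simpa [ht] using rearr_le_of_norm_le hM t
  · rw [rearr_eq_zero_of_volume_le hK]
    · exact zero_le
    · exact ENNReal.le_ofReal_iff_toReal_le hKfin (ENNReal.toReal_nonneg.trans (not_lt.1 ht)) |>.2
        (not_lt.1 ht)

theorem lorentzNorm_le_of_norm_le {p : ℝ} (hp : 0 < p) (hM : ∀ x, ‖f x‖ ≤ M)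
    (hK : ∀ x, x ∉ K → f x = 0) (hKfin : volume K ≠ ⊤) :
    lorentzNorm p Ω f ≤ ENNReal.ofReal (p * (volume K).toReal ^ (1 / p)) * M := by
  rw [← lintegral_Ioo_rpow_div hp ENNReal.toReal_nonneg,
    ← lintegral_mul_const' _ _ ENNReal.coe_ne_top, ← Ioi_inter_Iio, inter_comm,
    ← Measure.restrict_restrict measurableSet_Iio, ← lintegral_indicator measurableSet_Iio]
  refine lintegral_mono fun t => ?_
  refine (mul_le_mul_right (rearr_le_indicator hM hK hKfin t) _).trans ?_
  by_cases ht : t < (volume K).toReal <;> simp [ht]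

/-- The bound does not depend on `t`, so `f**` decays like `1/t`. This controls the maximal norm at
infinity. -/
theorem lintegral_rearr_le (hM : ∀ x, ‖f x‖ ≤ M) (hK : ∀ x, x ∉ K → f x = 0)
    (hKfin : volume K ≠ ⊤) (t : ℝ) : ∫⁻ s in Ioo 0 t, rearr Ω f s ≤ M * volume K := by
  calc ∫⁻ s in Ioo 0 t, rearr Ω f s
      ≤ ∫⁻ s in Ioi (0 : ℝ), (Iio (volume K).toReal).indicator (fun _ => (M : ℝ≥0∞)) s :=
        (lintegral_mono_set Ioo_subset_Ioi_self).trans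
          (lintegral_mono fun s => rearr_le_indicator hM hK hKfin s)
    _ = M * volume K := by
        rw [lintegral_indicator measurableSet_Iio, Measure.restrict_restrict measurableSet_Iio,
          inter_comm, Ioi_inter_Iio]
        simp [ENNReal.ofReal_toReal hKfin]

theorem measurable_maxRearr (Ω : Set (Rn n)) (f : Rn n → F) : Measurable (maxRearr Ω f) := by
  have : Monotone fun t : ℝ => ∫⁻ s in Ioo 0 t, rearr Ω f s := fun a b hab =>
    lintegral_mono_set (Ioo_subset_Ioo_right hab)
  exact ENNReal.measurable_ofReal.inv.mul this.measurable

theorem maxRearr_le_of_norm_le (hM : ∀ x, ‖f x‖ ≤ M) (t : ℝ) : maxRearr Ω f t ≤ M := by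
  calc maxRearr Ω f t ≤ (ENNReal.ofReal t)⁻¹ * ∫⁻ _ in Ioo 0 t, (M : ℝ≥0∞) :=
        mul_le_mul_right (lintegral_mono fun s => rearr_le_of_norm_le hM s) _
    _ = ((ENNReal.ofReal t)⁻¹ * ENNReal.ofReal t) * M := by simp; ring
    _ ≤ 1 * M := mul_le_mul_left (ENNReal.inv_mul_le_one _) _
    _ = M := one_mul _

variable {f : ℕ → Rn n → F}

/-- On the finite measure set `K ∩ Ω`, pointwise convergence gives convergence in measure.
Eventually the level set at height `s` has measure at most `t`, that is, the rearrangement at `t` is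
at most `s`. -/
theorem tendsto_rearr_zero (hΩ : MeasurableSet Ω)
    (hf : ∀ k, AEStronglyMeasurable (f k) (volume.restrict Ω))
    (hK : ∀ k x, x ∉ K → f k x = 0) (hKm : MeasurableSet K) (hKfin : volume K ≠ ⊤)
    (hlim : ∀ x, Tendsto (fun k => f k x) atTop (𝓝 0)) {t : ℝ} (ht : 0 < t) :
    Tendsto (fun k => rearr Ω (f k) t) atTop (𝓝 0) := by
  have hfin : IsFiniteMeasure (volume.restrict (K ∩ Ω)) :=
    ⟨by simpa using (measure_mono inter_subset_left).trans_lt hKfin.lt_top⟩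
  have hmeas : TendstoInMeasure (volume.restrict (K ∩ Ω)) f atTop (fun _ => 0) :=
    tendstoInMeasure_of_tendsto_ae (fun k => (hf k).mono_set inter_subset_right)
      (Eventually.of_forall hlim)
  rw [ENNReal.tendsto_nhds_zero]
  intro ε hε
  obtain ⟨s, hs0, hsε⟩ := ENNReal.lt_iff_exists_nnreal_btwn.1 hε
  have ht' : 0 < ENNReal.ofReal t := by simpa using ht
  filter_upwards [(hmeas s hs0).eventually (gt_mem_nhds ht')] with k hk
  refine (rearr_le_of_distribFun_le (le_trans ?_ hk.le)).trans hsε.le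
  rw [Measure.restrict_apply' (hKm.inter hΩ)]
  refine measure_mono fun x hx => ⟨?_, ?_, hx.1⟩
  · change (s : ℝ≥0∞) ≤ edist (f k x) 0
    rw [edist_zero_right, enorm_eq_nnnorm, ENNReal.coe_le_coe]
    exact_mod_cast hx.2.le
  · by_contra h
    have := hx.2
    rw [hK k x h, norm_zero] at this
    exact absurd s.2 (not_le.2 this)

theorem tendsto_maxRearr_zero (hΩ : MeasurableSet Ω)
    (hf : ∀ k, AEStronglyMeasurable (f k) (volume.restrict Ω)) (hM : ∀ k x, ‖f k x‖ ≤ M)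
    (hK : ∀ k x, x ∉ K → f k x = 0) (hKm : MeasurableSet K) (hKfin : volume K ≠ ⊤)
    (hlim : ∀ x, Tendsto (fun k => f k x) atTop (𝓝 0)) {t : ℝ} (ht : 0 < t) :
    Tendsto (fun k => maxRearr Ω (f k) t) atTop (𝓝 0) := by
  have h : Tendsto (fun k => ∫⁻ s in Ioo 0 t, rearr Ω (f k) s) atTop
      (𝓝 (∫⁻ _ in Ioo 0 t, (0 : ℝ≥0∞))) := by
    refine tendsto_lintegral_of_dominated_convergence (fun _ => (M : ℝ≥0∞))
      (fun k => measurable_rearr Ω (f k))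
      (fun k => Eventually.of_forall fun s => rearr_le_of_norm_le (hM k) s) ?_ ?_
    · simpa using ENNReal.mul_ne_top ENNReal.coe_ne_top ENNReal.ofReal_ne_top
    · filter_upwards [ae_restrict_mem measurableSet_Ioo] with s hs
      exact tendsto_rearr_zero hΩ hf hK hKm hKfin hlim hs.1
  have h2 := ENNReal.Tendsto.const_mul (a := (ENNReal.ofReal t)⁻¹) h (Or.inr (by simpa using ht))
  simpa [maxRearr] using h2

theorem lintegral_Ioi_one_rpow_div_lt_top {p : ℝ} (hp : 1 < p) :
    ∫⁻ t in Ioi (1 : ℝ), ENNReal.ofReal (t ^ (1 / p) / t) * (ENNReal.ofReal t)⁻¹ < ⊤ := by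
  have hp' : 1 / p - 2 < -1 := by
    have : 1 / p < 1 := by rw [div_lt_one (by positivity)]; exact hp
    linarith
  have hint := integrableOn_Ioi_rpow_of_lt hp' one_pos
  refine lt_of_le_of_lt (le_of_eq ?_) hint.lintegral_lt_top
  refine setLIntegral_congr_fun measurableSet_Ioi fun t (ht : 1 < t) => ?_
  have ht0 : 0 < t := one_pos.trans ht
  rw [← ENNReal.ofReal_inv_of_pos ht0, ← ENNReal.ofReal_mul (by positivity),
    Real.rpow_sub ht0]
  congr 1
  rw [Real.rpow_two]
  field_simp

/-- Dominated convergence in `L^{(p,1)}` for bounded functions with a common support of finite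
measure. -/
theorem tendsto_lorentzMaxNorm_zero {p : ℝ} (hp : 1 < p) (hΩ : MeasurableSet Ω)
    (hf : ∀ k, AEStronglyMeasurable (f k) (volume.restrict Ω)) (hM : ∀ k x, ‖f k x‖ ≤ M)
    (hK : ∀ k x, x ∉ K → f k x = 0) (hKm : MeasurableSet K) (hKfin : volume K ≠ ⊤)
    (hlim : ∀ x, Tendsto (fun k => f k x) atTop (𝓝 0)) :
    Tendsto (fun k => lorentzMaxNorm p Ω (f k)) atTop (𝓝 0) := by
  have hp0 : 0 < p := one_pos.trans hp
  have hwm : Measurable fun t : ℝ => ENNReal.ofReal (t ^ (1 / p) / t) := by fun_prop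
  have h : Tendsto (fun k => lorentzMaxNorm p Ω (f k)) atTop
      (𝓝 (∫⁻ _ in Ioi (0 : ℝ), (0 : ℝ≥0∞))) := by
    refine tendsto_lintegral_of_dominated_convergence
      -- The majorant uses `f** ≤ M` for small `t` and `f** ≤ M |K| / t` for large `t`; the tail
      -- `t^{1/p - 2}` is integrable because `p > 1`.
      (fun t => ENNReal.ofReal (t ^ (1 / p) / t) *
        if t ≤ 1 then (M : ℝ≥0∞) else (ENNReal.ofReal t)⁻¹ * (M * volume K))
      (fun k => hwm.mul (measurable_maxRearr Ω (f k)))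
      (fun k => Eventually.of_forall fun t => mul_le_mul_right ?_ _) ?_ ?_
    · split_ifs
      · exact maxRearr_le_of_norm_le (hM k) t
      · exact mul_le_mul_right (lintegral_rearr_le (hM k) (hK k) hKfin t) _
    · refine ne_of_lt ?_
      rw [← Ioc_union_Ioi_eq_Ioi zero_le_one]
      refine (lintegral_union_le _ _ _).trans_lt (ENNReal.add_lt_top.2 ⟨?_, ?_⟩)
      · calc _ = ∫⁻ t in Ioc (0 : ℝ) 1, ENNReal.ofReal (t ^ (1 / p) / t) * M :=
              setLIntegral_congr_fun measurableSet_Ioc fun t ht => by simp [ht.2]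
          _ = ENNReal.ofReal (p * 1 ^ (1 / p)) * M := by
              rw [lintegral_mul_const' _ _ ENNReal.coe_ne_top,
                ← Measure.restrict_congr_set Ioo_ae_eq_Ioc, lintegral_Ioo_rpow_div hp0 zero_le_one]
          _ < ⊤ := ENNReal.mul_lt_top ENNReal.ofReal_lt_top ENNReal.coe_lt_top
      · have hMK : (M : ℝ≥0∞) * volume K ≠ ⊤ := ENNReal.mul_ne_top ENNReal.coe_ne_top hKfin
        calc _ = ∫⁻ t in Ioi (1 : ℝ),
                ENNReal.ofReal (t ^ (1 / p) / t) * (ENNReal.ofReal t)⁻¹ * (M * volume K) :=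
              setLIntegral_congr_fun measurableSet_Ioi fun t (ht : 1 < t) => by
                simp [not_le.2 ht, mul_assoc]
          _ < ⊤ := by
              rw [lintegral_mul_const' _ _ hMK]
              exact ENNReal.mul_lt_top (lintegral_Ioi_one_rpow_div_lt_top hp) hMK.lt_top
    · filter_upwards [ae_restrict_mem measurableSet_Ioi] with t ht
      have := ENNReal.Tendsto.const_mul (a := ENNReal.ofReal (t ^ (1 / p) / t))
        (tendsto_maxRearr_zero hΩ hf hM hK hKm hKfin hlim ht) (Or.inr ENNReal.ofReal_ne_top)
      simpa using this
  simpa using h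

end Bounded

/-! ### Integration by parts and bounded pointwise limits of test functions. -/

theorem gradient_apply (φ : Rn n → ℝ) (x : Rn n) (i : Fin n) :
    gradient φ x i = fderiv ℝ φ x (EuclideanSpace.single i 1) := by
  rw [← InnerProductSpace.toDual_symm_apply (𝕜 := ℝ) (y := fderiv ℝ φ x), ← gradient,
    EuclideanSpace.inner_single_right]
  simp

/-- Integration by parts for test functions. -/
theorem IsTestFun.integral_mul_gradient {Ω : Set (Rn n)} {φ ψ : Rn n → ℝ} (hφ : IsTestFun Ω φ)
    (hψ : IsTestFun Ω ψ) (i : Fin n) :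
    ∫ x in Ω, ψ x * gradient φ x i =
      -∫ x in Ω, fderiv ℝ ψ x (EuclideanSpace.single i 1) * φ x := by
  have hφ0 : ∀ x, x ∉ Ω → φ x = 0 := fun x hx =>
    image_eq_zero_of_notMem_tsupport fun h => hx (hφ.2.2 h)
  have hψ0 : ∀ x, x ∉ Ω → ψ x = 0 := fun x hx =>
    image_eq_zero_of_notMem_tsupport fun h => hx (hψ.2.2 h)
  rw [setIntegral_eq_integral_of_forall_compl_eq_zero fun x hx => by simp [hψ0 x hx],
    setIntegral_eq_integral_of_forall_compl_eq_zero fun x hx => by simp [hφ0 x hx]]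
  simp only [gradient_apply]
  have hdφ : Continuous fun x => fderiv ℝ φ x (EuclideanSpace.single i 1) :=
    (hφ.1.continuous_fderiv (by simp)).clm_apply continuous_const
  have hdψ : Continuous fun x => fderiv ℝ ψ x (EuclideanSpace.single i 1) :=
    (hψ.1.continuous_fderiv (by simp)).clm_apply continuous_const
  refine integral_mul_fderiv_eq_neg_fderiv_mul_of_integrable ?_ ?_ ?_
    (fun x _ => hψ.1.differentiable (by simp) x) (fun x _ => hφ.1.differentiable (by simp) x)
  · exact (hdψ.mul hφ.1.continuous).integrable_of_hasCompactSupport hφ.2.1.mul_left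
  · exact (hψ.1.continuous.mul hdφ).integrable_of_hasCompactSupport hψ.2.1.mul_right
  · exact (hψ.1.continuous.mul hφ.1.continuous).integrable_of_hasCompactSupport hψ.2.1.mul_right

section Limit

variable {Ω K : Set (Rn n)} {φ : ℕ → Rn n → ℝ} {u : Rn n → ℝ} {v : Rn n → Rn n} {M : ℝ≥0}

theorem locallyIntegrable_of_tendsto {F : Type*} [NormedAddCommGroup F] {f : ℕ → Rn n → F}
    {g : Rn n → F} (hf : ∀ k, AEStronglyMeasurable (f k) volume)
    (hM : ∀ k x, ‖f k x‖ ≤ M) (hlim : ∀ x, Tendsto (fun k => f k x) atTop (𝓝 (g x))) :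
    LocallyIntegrable g := by
  have hg := aestronglyMeasurable_of_tendsto_ae atTop hf (Eventually.of_forall hlim)
  have hgM : ∀ x, ‖g x‖ ≤ M := fun x => le_of_tendsto' (hlim x).norm fun k => hM k x
  exact (locallyIntegrable_const (M : ℝ)).mono hg
    (Eventually.of_forall fun x => by simpa using hgM x)

/-- Both sides of the integration by parts identity converge by dominated convergence, with
majorants `M |ψ|` and `M |∂ᵢψ|`. -/
theorem hasWeakGradient_of_tendsto (hφ : ∀ k, IsTestFun Ω (φ k)) (hM : ∀ k x, ‖φ k x‖ ≤ M)
    (hM' : ∀ k x, ‖gradient (φ k) x‖ ≤ M)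
    (hlim : ∀ x, Tendsto (fun k => φ k x) atTop (𝓝 (u x)))
    (hlim' : ∀ x, Tendsto (fun k => gradient (φ k) x) atTop (𝓝 (v x))) :
    HasWeakGradient Ω u v := by
  refine ⟨(locallyIntegrable_of_tendsto (fun k => (hφ k).1.continuous.aestronglyMeasurable)
    hM hlim).locallyIntegrableOn _,
    (locallyIntegrable_of_tendsto (fun k => (continuous_gradient (hφ k).1).aestronglyMeasurable)
    hM' hlim').locallyIntegrableOn _, fun ψ hψ i => ?_⟩
  have hdψ : Continuous fun x => fderiv ℝ ψ x (EuclideanSpace.single i 1) :=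
    (hψ.1.continuous_fderiv (by simp)).clm_apply continuous_const
  have hcoord : ∀ k, Continuous fun x => gradient (φ k) x i := fun k =>
    (EuclideanSpace.proj (𝕜 := ℝ) i).continuous.comp (continuous_gradient (hφ k).1)
  have hψi : Integrable ψ := hψ.1.continuous.integrable_of_hasCompactSupport hψ.2.1
  have hdψi : Integrable fun x => fderiv ℝ ψ x (EuclideanSpace.single i 1) :=
    hdψ.integrable_of_hasCompactSupport (hψ.2.1.fderiv_apply ℝ _)
  have h1 : Tendsto (fun k => ∫ x in Ω, ψ x * gradient (φ k) x i) atTop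
      (𝓝 (∫ x in Ω, ψ x * v x i)) := by
    refine tendsto_integral_of_dominated_convergence (fun x => ‖ψ x‖ * M)
      (fun k => (hψ.1.continuous.mul (hcoord k)).aestronglyMeasurable)
      (hψi.norm.mul_const _).integrableOn (fun k => Eventually.of_forall fun x => ?_)
      (Eventually.of_forall fun x => ?_)
    · rw [norm_mul]
      exact mul_le_mul_of_nonneg_left ((PiLp.norm_apply_le _ i).trans (hM' k x))
        (norm_nonneg _)
    · exact (((EuclideanSpace.proj (𝕜 := ℝ) i).continuous.tendsto _).comp (hlim' x)).const_mul _
  have h2 : Tendsto (fun k => -∫ x in Ω, fderiv ℝ ψ x (EuclideanSpace.single i 1) * φ k x) atTop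
      (𝓝 (-∫ x in Ω, fderiv ℝ ψ x (EuclideanSpace.single i 1) * u x)) := by
    refine Tendsto.neg (tendsto_integral_of_dominated_convergence
      (fun x => ‖fderiv ℝ ψ x (EuclideanSpace.single i 1)‖ * M)
      (fun k => (hdψ.mul (hφ k).1.continuous).aestronglyMeasurable)
      (hdψi.norm.mul_const _).integrableOn (fun k => Eventually.of_forall fun x => ?_)
      (Eventually.of_forall fun x => ?_))
    · rw [norm_mul]
      exact mul_le_mul_of_nonneg_left (hM k x) (norm_nonneg _)
    · exact (hlim x).const_mul _
  refine tendsto_nhds_unique h1 ?_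
  simpa only [fun k => (hφ k).integral_mul_gradient hψ i] using h2

/-- Reduces membership in the closure to pointwise convergence of functions and gradients under a
common bound and a common support of finite measure. The limits inherit both, so dominated
convergence applies to the differences. -/
theorem memH0_of_tendsto {p : ℝ} (hp : 1 < p) (hΩ : MeasurableSet Ω)
    (hφ : ∀ k, IsTestFun Ω (φ k)) (hM : ∀ k x, ‖φ k x‖ ≤ M)
    (hM' : ∀ k x, ‖gradient (φ k) x‖ ≤ M) (hKm : MeasurableSet K) (hKfin : volume K ≠ ⊤)
    (hK : ∀ k x, x ∉ K → φ k x = 0) (hK' : ∀ k x, x ∉ K → gradient (φ k) x = 0)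
    (hlim : ∀ x, Tendsto (fun k => φ k x) atTop (𝓝 (u x)))
    (hlim' : ∀ x, Tendsto (fun k => gradient (φ k) x) atTop (𝓝 (v x))) :
    MemH0 p Ω u := by
  have aux : ∀ {F : Type} [NormedAddCommGroup F] {f : ℕ → Rn n → F} {g : Rn n → F},
      (∀ k, AEStronglyMeasurable (f k) volume) → (∀ k x, ‖f k x‖ ≤ M) →
      (∀ k x, x ∉ K → f k x = 0) → (∀ x, Tendsto (fun k => f k x) atTop (𝓝 (g x))) →
      Tendsto (fun k => lorentzMaxNorm p Ω (fun x => f k x - g x)) atTop (𝓝 0) := by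
    intro F _ f g hf hfM hfK hfg
    have hg := aestronglyMeasurable_of_tendsto_ae atTop hf (Eventually.of_forall hfg)
    have hgM : ∀ x, ‖g x‖ ≤ M := fun x => le_of_tendsto' (hfg x).norm fun k => hfM k x
    refine tendsto_lorentzMaxNorm_zero (M := M + M) (K := K) hp hΩ
      (fun k => ((hf k).sub hg).restrict) (fun k x => ?_) (fun k x hx => ?_) hKm hKfin
      (fun x => ?_)
    · push_cast
      exact (norm_sub_le _ _).trans (add_le_add (hfM k x) (hgM x))
    · have : g x = 0 := tendsto_nhds_unique (hfg x) (by simp [hfK _ x hx])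
      rw [hfK k x hx, this, sub_zero]
    · simpa using (hfg x).sub_const (g x)
  refine ⟨v, hasWeakGradient_of_tendsto hφ hM hM' hlim hlim', φ, hφ, ?_⟩
  have h1 := aux (fun k => (hφ k).1.continuous.aestronglyMeasurable) hM hK hlim
  have h2 := aux (fun k => (continuous_gradient (hφ k).1).aestronglyMeasurable) hM' hK' hlim'
  simpa [sobolevLorentzNorm] using h1.add h2

end Limit

/-! ### Smooth approximation of cones, and extremality. -/

noncomputable section

/-- A smooth approximation of the positive part: `y exp(-1/y)` for `y > 0` and `0` for `y ≤ 0`. -/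
def smoothPosPart (y : ℝ) : ℝ := y * expNegInvGlue y

/-- The derivative of `smoothPosPart`. -/
def smoothPosPartDeriv (y : ℝ) : ℝ := (1 + y⁻¹) * expNegInvGlue y

theorem hasDerivAt_smoothPosPart (y : ℝ) :
    HasDerivAt smoothPosPart (smoothPosPartDeriv y) y := by
  have h : HasDerivAt expNegInvGlue (y⁻¹ ^ 2 * expNegInvGlue y) y := by
    simpa using expNegInvGlue.hasDerivAt_polynomial_eval_inv_mul 1 y
  refine ((hasDerivAt_id y).mul h).congr_deriv ?_
  -- At `0` the formula survives because `expNegInvGlue 0 = 0`, whatever value `0⁻¹` takes.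
  rcases eq_or_ne y 0 with rfl | hy
  · simp [smoothPosPartDeriv]
  · simp only [smoothPosPartDeriv, id]
    field_simp

theorem contDiff_smoothPosPart : ContDiff ℝ ∞ smoothPosPart :=
  contDiff_id.mul expNegInvGlue.contDiff

theorem smoothPosPart_of_nonpos {y : ℝ} (hy : y ≤ 0) : smoothPosPart y = 0 := by
  simp [smoothPosPart, hy]

theorem smoothPosPartDeriv_of_nonpos {y : ℝ} (hy : y ≤ 0) : smoothPosPartDeriv y = 0 := by
  simp [smoothPosPartDeriv, hy]

theorem expNegInvGlue_of_pos {y : ℝ} (hy : 0 < y) : expNegInvGlue y = Real.exp (-y⁻¹) := by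
  simp [expNegInvGlue, not_le.2 hy]

theorem tendsto_expNegInvGlue_atTop : Tendsto expNegInvGlue atTop (𝓝 1) := by
  have h : Tendsto (fun y : ℝ => Real.exp (-y⁻¹)) atTop (𝓝 1) := by
    simpa [Function.comp_def] using
      (Real.continuous_exp.tendsto _).comp (tendsto_inv_atTop_zero (𝕜 := ℝ)).neg
  refine h.congr' ?_
  filter_upwards [eventually_gt_atTop 0] with y hy
  rw [expNegInvGlue_of_pos hy]

theorem tendsto_smoothPosPartDeriv_atTop : Tendsto smoothPosPartDeriv atTop (𝓝 1) := by
  have h := ((tendsto_inv_atTop_zero (𝕜 := ℝ)).const_add 1).mul tendsto_expNegInvGlue_atTop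
  rw [add_zero, one_mul] at h
  exact h

/-- With `z = 1/y` this is `1 + z ≤ exp z`. It makes the gradient bound for `smoothCone` uniform in
`ε`. -/
theorem abs_smoothPosPartDeriv_le (y : ℝ) : |smoothPosPartDeriv y| ≤ 1 := by
  rcases le_or_gt y 0 with hy | hy
  · simp [smoothPosPartDeriv_of_nonpos hy]
  · have hy' : 0 < y⁻¹ := inv_pos.2 hy
    rw [smoothPosPartDeriv, expNegInvGlue_of_pos hy, abs_of_nonneg (by positivity), Real.exp_neg,
      ← div_eq_mul_inv, div_le_one (Real.exp_pos _), add_comm]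
    exact Real.add_one_le_exp _

theorem smoothPosPart_nonneg (y : ℝ) : 0 ≤ smoothPosPart y := by
  rcases le_or_gt y 0 with hy | hy
  · rw [smoothPosPart_of_nonpos hy]
  · exact mul_nonneg hy.le (expNegInvGlue.nonneg y)

theorem smoothPosPart_le_max (y : ℝ) : smoothPosPart y ≤ max y 0 := by
  rcases le_or_gt y 0 with hy | hy
  · rw [smoothPosPart_of_nonpos hy]
    exact le_max_right _ _
  · refine le_trans ?_ (le_max_left _ _)
    refine mul_le_of_le_one_right hy.le ?_
    rw [expNegInvGlue_of_pos hy, Real.exp_le_one_iff]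
    exact neg_nonpos.2 (inv_pos.2 hy).le

/-- A smooth approximation of `cone a r`. -/
def smoothCone (a : Rn n) (r ε : ℝ) (x : Rn n) : ℝ :=
  ε * smoothPosPart ((1 - √(‖x - a‖ ^ 2 + ε ^ 2) / r) / ε)

/-- The gradient of `cone a r`. -/
def coneGradient (a : Rn n) (r : ℝ) (x : Rn n) : Rn n :=
  if ‖x - a‖ < r then -(r * ‖x - a‖)⁻¹ • (x - a) else 0

section SmoothCone

variable {a x : Rn n} {r ε : ℝ}

/-- The square root smooths the norm at the apex, and the rescaled `smoothPosPart` smooths the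
corner at the rim. -/
theorem contDiff_smoothCone (a : Rn n) (r : ℝ) (hε : 0 < ε) :
    ContDiff ℝ ∞ (smoothCone a r ε) := by
  have h1 : ContDiff ℝ ∞ fun x : Rn n => √(‖x - a‖ ^ 2 + ε ^ 2) :=
    (((contDiff_id.sub contDiff_const).norm_sq ℝ).add contDiff_const).sqrt
      fun x => by positivity
  exact contDiff_const.mul
    (contDiff_smoothPosPart.comp ((contDiff_const.sub (h1.div_const r)).div_const ε))

theorem norm_lt_sqrt (hε : 0 < ε) (z : Rn n) : ‖z‖ < √(‖z‖ ^ 2 + ε ^ 2) := by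
  refine Real.lt_sqrt_of_sq_lt ?_
  have : 0 < ε ^ 2 := by positivity
  linarith

/-- The square root exceeds the norm, so the regularisation only shrinks the support. No room around
the closed ball is needed inside `Ω`. -/
theorem profile_nonpos (hr : 0 < r) (hε : 0 < ε) (hx : x ∉ Metric.ball a r) :
    (1 - √(‖x - a‖ ^ 2 + ε ^ 2) / r) / ε ≤ 0 := by
  refine div_nonpos_of_nonpos_of_nonneg ?_ hε.le
  rw [sub_nonpos, one_le_div hr]
  rw [Metric.mem_ball, dist_eq_norm, not_lt] at hx
  exact hx.trans (norm_lt_sqrt hε _).le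

theorem smoothCone_eq_zero (hr : 0 < r) (hε : 0 < ε) (hx : x ∉ Metric.ball a r) :
    smoothCone a r ε x = 0 := by
  rw [smoothCone, smoothPosPart_of_nonpos (profile_nonpos hr hε hx), mul_zero]

theorem gradient_smoothCone (a : Rn n) (r : ℝ) (hε : 0 < ε) (x : Rn n) :
    gradient (smoothCone a r ε) x =
      -(smoothPosPartDeriv ((1 - √(‖x - a‖ ^ 2 + ε ^ 2) / r) / ε) *
        (r * √(‖x - a‖ ^ 2 + ε ^ 2))⁻¹) • (x - a) := by
  have hpos : 0 < ‖x - a‖ ^ 2 + ε ^ 2 := by positivity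
  -- The function is differentiated through `‖x - a‖ ^ 2`, which is smooth at `a` too.
  have hP : HasDerivAt (fun s : ℝ => ε * smoothPosPart ((1 - √(s + ε ^ 2) / r) / ε))
      (ε * (smoothPosPartDeriv ((1 - √(‖x - a‖ ^ 2 + ε ^ 2) / r) / ε) *
        (-(1 / (2 * √(‖x - a‖ ^ 2 + ε ^ 2)) / r) / ε))) (‖x - a‖ ^ 2) := by
    have h1 : HasDerivAt (fun s : ℝ => √(s + ε ^ 2)) (1 / (2 * √(‖x - a‖ ^ 2 + ε ^ 2)))
        (‖x - a‖ ^ 2) := ((hasDerivAt_id _).add_const _).sqrt hpos.ne'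
    have h2 := ((h1.div_const r).const_sub 1).div_const ε
    exact ((hasDerivAt_smoothPosPart _).comp _ h2).const_mul ε
  have hN : HasFDerivAt (fun y : Rn n => ‖y - a‖ ^ 2) (2 • innerSL ℝ (x - a)) x := by
    simpa using ((hasFDerivAt_id x).sub_const a).norm_sq
  have hφ := hP.comp_hasFDerivAt x hN
  have hg : HasGradientAt (smoothCone a r ε)
      (-(smoothPosPartDeriv ((1 - √(‖x - a‖ ^ 2 + ε ^ 2) / r) / ε) *
        (r * √(‖x - a‖ ^ 2 + ε ^ 2))⁻¹) • (x - a)) x := by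
    rw [hasGradientAt_iff_hasFDerivAt]
    refine HasFDerivAt.congr_fderiv (f := smoothCone a r ε) hφ ?_
    ext y
    simp only [InnerProductSpace.toDual_apply_apply, inner_smul_left, smul_apply,
      innerSL_apply_apply, smul_eq_mul, nsmul_eq_mul]
    have : √(‖x - a‖ ^ 2 + ε ^ 2) ≠ 0 := (Real.sqrt_pos.2 hpos).ne'
    simp
    field_simp
  exact hg.gradient

theorem isTestFun_smoothCone {Ω : Set (Rn n)} (hr : 0 < r) (hε : 0 < ε)
    (hΩ : Metric.closedBall a r ⊆ Ω) : IsTestFun Ω (smoothCone a r ε) := by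
  have h0 : ∀ x, x ∉ Metric.closedBall a r → smoothCone a r ε x = 0 := fun x hx =>
    smoothCone_eq_zero hr hε fun h => hx (Metric.ball_subset_closedBall h)
  refine ⟨contDiff_smoothCone a r hε, HasCompactSupport.intro (isCompact_closedBall a r) h0,
    (closure_minimal (fun x hx => ?_) Metric.isClosed_closedBall).trans hΩ⟩
  by_contra h
  exact hx (h0 x h)

theorem norm_smoothCone_le (hr : 0 < r) (hε : 0 < ε) (x : Rn n) :
    ‖smoothCone a r ε x‖ ≤ 1 := by
  rw [smoothCone, Real.norm_of_nonneg (mul_nonneg hε.le (smoothPosPart_nonneg _))]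
  calc _ ≤ ε * max ((1 - √(‖x - a‖ ^ 2 + ε ^ 2) / r) / ε) 0 :=
        mul_le_mul_of_nonneg_left (smoothPosPart_le_max _) hε.le
    _ ≤ ε * (1 / ε) := by
        refine mul_le_mul_of_nonneg_left (max_le ?_ (by positivity)) hε.le
        gcongr
        have : 0 ≤ √(‖x - a‖ ^ 2 + ε ^ 2) / r := by positivity
        linarith
    _ = 1 := by field_simp

theorem norm_gradient_smoothCone_le (hr : 0 < r) (hε : 0 < ε) (x : Rn n) :
    ‖gradient (smoothCone a r ε) x‖ ≤ 1 / r := by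
  have hq := norm_lt_sqrt hε (x - a)
  have hq0 : 0 < √(‖x - a‖ ^ 2 + ε ^ 2) := (norm_nonneg _).trans_lt hq
  rw [gradient_smoothCone a r hε, norm_smul, norm_neg, norm_mul, Real.norm_eq_abs,
    Real.norm_of_nonneg (by positivity)]
  calc _ ≤ 1 * (r * √(‖x - a‖ ^ 2 + ε ^ 2))⁻¹ * √(‖x - a‖ ^ 2 + ε ^ 2) := by
        gcongr
        exact abs_smoothPosPartDeriv_le _
    _ = 1 / r := by field_simp

theorem gradient_smoothCone_eq_zero (hr : 0 < r) (hε : 0 < ε) (hx : x ∉ Metric.ball a r) :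
    gradient (smoothCone a r ε) x = 0 := by
  rw [gradient_smoothCone a r hε, smoothPosPartDeriv_of_nonpos (profile_nonpos hr hε hx)]
  simp

variable {e : ℕ → ℝ}

theorem tendsto_sqrt_norm (he0 : Tendsto e atTop (𝓝 0)) (z : Rn n) :
    Tendsto (fun k => √(‖z‖ ^ 2 + e k ^ 2)) atTop (𝓝 ‖z‖) := by
  have : Tendsto (fun k => √(‖z‖ ^ 2 + e k ^ 2)) atTop (𝓝 √(‖z‖ ^ 2 + 0 ^ 2)) :=
    (tendsto_const_nhds.add (he0.pow 2)).sqrt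
  simpa using this

/-- Inside the ball the numerator has a positive limit while `e k` decreases to `0` through positive
values; hence the smoothing factors tend to `1` there. -/
theorem tendsto_profile (hr : 0 < r) (he : ∀ k, 0 < e k) (he0 : Tendsto e atTop (𝓝 0))
    (hx : x ∈ Metric.ball a r) :
    Tendsto (fun k => (1 - √(‖x - a‖ ^ 2 + e k ^ 2) / r) / e k) atTop atTop := by
  have hx' : 0 < 1 - ‖x - a‖ / r := by
    rw [sub_pos, div_lt_one hr]
    simpa [dist_eq_norm] using hx
  refine Tendsto.pos_mul_atTop hx' (((tendsto_sqrt_norm he0 (x - a)).div_const r).const_sub 1) ?_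
  exact (tendsto_nhdsWithin_iff.2 ⟨he0, Eventually.of_forall he⟩).inv_tendsto_nhdsGT_zero

theorem tendsto_smoothCone (hr : 0 < r) (he : ∀ k, 0 < e k) (he0 : Tendsto e atTop (𝓝 0))
    (x : Rn n) : Tendsto (fun k => smoothCone a r (e k) x) atTop (𝓝 (cone a r x)) := by
  by_cases hx : x ∈ Metric.ball a r
  · have hx' : 0 < 1 - ‖x - a‖ / r := by
      rw [sub_pos, div_lt_one hr]
      simpa [dist_eq_norm] using hx
    have h := (((tendsto_sqrt_norm he0 (x - a)).div_const r).const_sub 1).mul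
      (tendsto_expNegInvGlue_atTop.comp (tendsto_profile hr he he0 hx))
    rw [mul_one] at h
    rw [cone, max_eq_left hx'.le]
    refine h.congr fun k => ?_
    have := (he k).ne'
    simp only [smoothCone, smoothPosPart, Function.comp]
    field_simp
  · have : cone a r x = 0 := by
      rw [Metric.mem_ball, dist_eq_norm, not_lt] at hx
      rw [cone, max_eq_right]
      rwa [sub_nonpos, one_le_div hr]
    simp [this, smoothCone_eq_zero hr (he _) hx]

theorem tendsto_gradient_smoothCone (hr : 0 < r) (he : ∀ k, 0 < e k)
    (he0 : Tendsto e atTop (𝓝 0)) (x : Rn n) :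
    Tendsto (fun k => gradient (smoothCone a r (e k)) x) atTop (𝓝 (coneGradient a r x)) := by
  by_cases hx : x ∈ Metric.ball a r
  · have hx' : ‖x - a‖ < r := by simpa [dist_eq_norm] using hx
    simp only [fun k => gradient_smoothCone a r (he k) x]
    rw [coneGradient, if_pos hx']
    -- At the apex every approximating gradient vanishes, as does `coneGradient`, so convergence
    -- holds at every point.
    rcases eq_or_ne x a with rfl | hxa
    · simp
    · have hne : r * ‖x - a‖ ≠ 0 := mul_ne_zero hr.ne' (norm_ne_zero_iff.2 (sub_ne_zero.2 hxa))
      have h := (tendsto_smoothPosPartDeriv_atTop.comp (tendsto_profile hr he he0 hx)).mul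
        (((tendsto_sqrt_norm he0 (x - a)).const_mul r).inv₀ hne)
      rw [one_mul] at h
      exact h.neg.smul_const _
  · have hx' : ¬ ‖x - a‖ < r := by simpa [dist_eq_norm] using hx
    simp [coneGradient, hx', gradient_smoothCone_eq_zero hr (he _) hx]

theorem norm_coneGradient_le (hr : 0 < r) (x : Rn n) : ‖coneGradient a r x‖ ≤ 1 / r := by
  rw [coneGradient]
  split_ifs
  · rcases eq_or_ne x a with rfl | hxa
    · simpa using hr.le
    · have : 0 < ‖x - a‖ := norm_pos_iff.2 (sub_ne_zero.2 hxa)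
      rw [norm_smul, norm_neg, Real.norm_of_nonneg (by positivity)]
      refine le_of_eq ?_
      field_simp
  · simpa using hr.le

theorem coneGradient_eq_zero (hx : x ∉ Metric.ball a r) : coneGradient a r x = 0 := by
  have hx' : ¬ ‖x - a‖ < r := by simpa [dist_eq_norm] using hx
  rw [coneGradient, if_neg hx']

end SmoothCone

theorem memH0_cone_and_hasWeakGradient (hn : 2 ≤ n) {Ω : Set (Rn n)} (hΩ : MeasurableSet Ω)
    {a : Rn n} {r : ℝ} (hr : 0 < r) (hball : Metric.closedBall a r ⊆ Ω) :
    MemH0 n Ω (cone a r) ∧ HasWeakGradient Ω (cone a r) (coneGradient a r) := by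
  set e : ℕ → ℝ := fun k => 1 / ((k : ℝ) + 1)
  have he : ∀ k, 0 < e k := fun k => by positivity
  have he0 : Tendsto e atTop (𝓝 0) := tendsto_one_div_add_atTop_nhds_zero_nat
  have hp : (1 : ℝ) < n := by exact_mod_cast (by omega : 1 < n)
  have hφ : ∀ k, IsTestFun Ω (smoothCone a r (e k)) := fun k => isTestFun_smoothCone hr (he k) hball
  have hr' : 0 ≤ 1 / r := by positivity
  set M : ℝ≥0 := ⟨1 + 1 / r, by positivity⟩
  have hMc : (M : ℝ) = 1 + 1 / r := rfl
  have hM : ∀ k x, ‖smoothCone a r (e k) x‖ ≤ M := fun k x => by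
    rw [hMc]; linarith [norm_smoothCone_le (a := a) hr (he k) x]
  have hM' : ∀ k x, ‖gradient (smoothCone a r (e k)) x‖ ≤ M := fun k x => by
    rw [hMc]; linarith [norm_gradient_smoothCone_le (a := a) hr (he k) x]
  exact ⟨memH0_of_tendsto (K := Metric.ball a r) hp hΩ hφ hM hM' measurableSet_ball
      measure_ball_lt_top.ne (fun k x hx => smoothCone_eq_zero hr (he k) hx)
      (fun k x hx => gradient_smoothCone_eq_zero hr (he k) hx)
      (tendsto_smoothCone hr he he0) (tendsto_gradient_smoothCone hr he he0),
    hasWeakGradient_of_tendsto hφ hM hM' (tendsto_smoothCone hr he he0)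
      (tendsto_gradient_smoothCone hr he he0)⟩

/-- The bound `1 / r` on a ball of measure `Ωₙ rⁿ` gives `n (Ωₙ rⁿ)^{1/n} / r = n Ωₙ^{1/n}`: the
radius cancels. An upper bound suffices, since the embedding supplies the reverse inequality. -/
theorem embeddingConst_mul_lorentzNorm_coneGradient_le (hn : 2 ≤ n) (Ω : Set (Rn n)) (a : Rn n)
    {r : ℝ} (hr : 0 < r) :
    ENNReal.ofReal (embeddingConst n) * lorentzNorm n Ω (coneGradient a r) ≤ 1 := by
  have hn0 : (0 : ℝ) < n := by exact_mod_cast (by omega : 0 < n)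
  have hV := unitBallVolume_pos n
  set M : ℝ≥0 := ⟨1 / r, by positivity⟩
  have hM : ∀ x, ‖coneGradient a r x‖ ≤ M := norm_coneGradient_le hr
  have hMc : (M : ℝ≥0∞) = ENNReal.ofReal (1 / r) := by
    rw [← ENNReal.ofReal_coe_nnreal]
    rfl
  refine (mul_le_mul_right (lorentzNorm_le_of_norm_le (K := Metric.ball a r) hn0 hM
    (fun x hx => coneGradient_eq_zero hx) measure_ball_lt_top.ne) _).trans ?_
  rw [hMc, ← ENNReal.ofReal_mul (by positivity),
    ← ENNReal.ofReal_mul (embeddingConst_pos hn).le, volume_ball_eq_ofReal a hr,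
    ENNReal.toReal_ofReal (by positivity), Real.mul_rpow hV.le (by positivity), one_div (n : ℝ),
    Real.pow_rpow_inv_natCast hr.le (by omega)]
  refine ENNReal.ofReal_le_one.2 (le_of_eq ?_)
  rw [embeddingConst, one_div (n : ℝ)]
  field_simp

theorem eLpNorm_cone {Ω : Set (Rn n)} (hΩ : IsOpen Ω) {a : Rn n} {r : ℝ} (hr : 0 < r)
    (ha : a ∈ Ω) : eLpNorm (cone a r) ⊤ (volume.restrict Ω) = 1 := by
  have hcont : Continuous (cone a r) := by unfold cone; fun_prop
  rw [eLpNorm_exponent_top]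
  refine le_antisymm ?_ ?_
  · refine eLpNormEssSup_le_of_ae_enorm_bound (Eventually.of_forall fun x => ?_)
    rw [← ofReal_norm, cone, Real.norm_of_nonneg (le_max_right _ _)]
    refine ENNReal.ofReal_le_one.2 (max_le ?_ zero_le_one)
    have : 0 ≤ ‖x - a‖ / r := by positivity
    linarith
  -- If the essential supremum `c` were below `1`, the open set where the cone exceeds `c` would
  -- contain the apex and so meet `Ω` in positive measure.
  · by_contra! hlt
    set c := eLpNormEssSup (cone a r) (volume.restrict Ω)
    have hU : IsOpen {x | c < ‖cone a r x‖ₑ} := isOpen_lt continuous_const hcont.enorm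
    have hpos : 0 < volume ({x | c < ‖cone a r x‖ₑ} ∩ Ω) := by
      refine (hU.inter hΩ).measure_pos volume ⟨a, ?_, ha⟩
      simpa [cone] using hlt
    have hzero : volume.restrict Ω {x | c < ‖cone a r x‖ₑ} = 0 := by
      have := enorm_ae_le_eLpNormEssSup (cone a r) (volume.restrict Ω)
      simpa [ae_iff, c] using this
    rw [Measure.restrict_apply hU.measurableSet] at hzero
    exact hpos.ne' hzero

end

end SobolevLorentz

/-! ### The theorem. -/

theorem mainTheorem3 (n : ℕ) (hn : 2 ≤ n) (Ω : Set (SobolevLorentz.Rn n)) (hΩ : IsOpen Ω) :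
    -- embedding, with the estimate and the boundary values
    (∀ u : SobolevLorentz.Rn n → ℝ, SobolevLorentz.MemH0 (n : ℝ) Ω u →
      (∃ w : SobolevLorentz.Rn n → ℝ,
        w =ᵐ[volume.restrict Ω] u ∧ ContinuousOn w (closure Ω) ∧
        MemLp w ∞ (volume.restrict Ω) ∧
        (Ω ≠ Set.univ → ∀ x ∈ frontier Ω, w x = 0)) ∧
      ∀ v : SobolevLorentz.Rn n → SobolevLorentz.Rn n, SobolevLorentz.HasWeakGradient Ω u v →
        eLpNorm u ∞ (volume.restrict Ω) ≤
          ENNReal.ofReal (SobolevLorentz.embeddingConst n) *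
            SobolevLorentz.lorentzNorm (n : ℝ) Ω v) ∧
    -- no smaller constant is possible, whatever the nonempty open set
    (Ω.Nonempty → ∀ C : ℝ≥0,
      (∀ (u : SobolevLorentz.Rn n → ℝ) (v : SobolevLorentz.Rn n → SobolevLorentz.Rn n),
        SobolevLorentz.MemH0 (n : ℝ) Ω u → SobolevLorentz.HasWeakGradient Ω u v →
        eLpNorm u ∞ (volume.restrict Ω) ≤ C * SobolevLorentz.lorentzNorm (n : ℝ) Ω v) →
      SobolevLorentz.embeddingConst n ≤ C) ∧
    -- equality holds for the cone functions
    (∀ (a : SobolevLorentz.Rn n) (r : ℝ), 0 < r → Metric.closedBall a r ⊆ Ω →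
      SobolevLorentz.MemH0 (n : ℝ) Ω (SobolevLorentz.cone a r) ∧
      eLpNorm (SobolevLorentz.cone a r) ∞ (volume.restrict Ω) = 1 ∧
      ∀ v : SobolevLorentz.Rn n → SobolevLorentz.Rn n,
        SobolevLorentz.HasWeakGradient Ω (SobolevLorentz.cone a r) v →
        eLpNorm (SobolevLorentz.cone a r) ∞ (volume.restrict Ω) =
          ENNReal.ofReal (SobolevLorentz.embeddingConst n) *
            SobolevLorentz.lorentzNorm (n : ℝ) Ω v) := by
  have sup_bound : ∀ u : SobolevLorentz.Rn n → ℝ, SobolevLorentz.MemH0 (n : ℝ) Ω u →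
      ∀ v : SobolevLorentz.Rn n → SobolevLorentz.Rn n, SobolevLorentz.HasWeakGradient Ω u v →
        eLpNorm u ∞ (volume.restrict Ω) ≤
          ENNReal.ofReal (SobolevLorentz.embeddingConst n) *
            SobolevLorentz.lorentzNorm (n : ℝ) Ω v := by
    intro u hu v hv
    obtain ⟨w, hwu, -, -, -, hle⟩ := hu.exists_continuous_version hn hΩ
    rw [← eLpNorm_congr_ae hwu, eLpNorm_exponent_top]
    exact eLpNormEssSup_le_of_ae_enorm_bound (Eventually.of_forall (hle v hv))
  have cone_extremal : ∀ (a : SobolevLorentz.Rn n) (r : ℝ), 0 < r → Metric.closedBall a r ⊆ Ω →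
      SobolevLorentz.MemH0 (n : ℝ) Ω (SobolevLorentz.cone a r) ∧
      eLpNorm (SobolevLorentz.cone a r) ∞ (volume.restrict Ω) = 1 ∧
      ∀ v : SobolevLorentz.Rn n → SobolevLorentz.Rn n,
        SobolevLorentz.HasWeakGradient Ω (SobolevLorentz.cone a r) v →
        eLpNorm (SobolevLorentz.cone a r) ∞ (volume.restrict Ω) =
          ENNReal.ofReal (SobolevLorentz.embeddingConst n) *
            SobolevLorentz.lorentzNorm (n : ℝ) Ω v := by
    intro a r hr hball
    obtain ⟨hmem, hgrad⟩ :=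
      SobolevLorentz.memH0_cone_and_hasWeakGradient hn hΩ.measurableSet hr hball
    have hone := SobolevLorentz.eLpNorm_cone hΩ hr (hball (Metric.mem_closedBall_self hr.le))
    refine ⟨hmem, hone, fun v hv => le_antisymm (sup_bound _ hmem v hv) ?_⟩
    rw [hone, SobolevLorentz.lorentzNorm_congr_ae hΩ.measurableSet (hv.ae_eq hΩ hgrad)]
    exact SobolevLorentz.embeddingConst_mul_lorentzNorm_coneGradient_le hn Ω a hr
  refine ⟨fun u hu => ⟨?_, sup_bound u hu⟩, ?_, cone_extremal⟩
  · obtain ⟨w, hwu, hwc, ⟨M, hM⟩, hw0, -⟩ := hu.exists_continuous_version hn hΩ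
    refine ⟨w, hwu, hwc.continuousOn,
      memLp_top_of_bound hwc.aestronglyMeasurable M (Eventually.of_forall hM), fun _ x hx => ?_⟩
    rw [hΩ.frontier_eq] at hx
    exact hw0 x hx.2
  · rintro ⟨a, ha⟩ C hC
    obtain ⟨r, hr, hball⟩ := Metric.nhds_basis_closedBall.mem_iff.1 (hΩ.mem_nhds ha)
    obtain ⟨hmem, hone, heq⟩ := cone_extremal a r hr hball
    obtain ⟨v, hv, -⟩ := id hmem
    have h1 := heq v hv
    have h2 := hC _ v hmem hv
    rw [hone] at h1 h2
    set L := SobolevLorentz.lorentzNorm (n : ℝ) Ω v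
    have hc := SobolevLorentz.embeddingConst_pos hn
    -- The cone equality reads `1 = embeddingConst n * L`, which forces `0 < L < ∞`, so `L` can be
    -- cancelled from the assumed inequality.
    have hL0 : L ≠ 0 := by
      rintro h
      simp [h] at h1
    have hLtop : L ≠ ⊤ := by
      rintro h
      rw [h, ENNReal.mul_top (by simpa using hc)] at h1
      exact ENNReal.one_ne_top h1
    rw [h1, ENNReal.mul_le_mul_iff_left hL0 hLtop] at h2
    simpa [ENNReal.ofReal_le_iff_le_toReal] using h2
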